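/- Let $d\ge 1$, $\mu<0$, $\nu>0$ and $\varphi\in\mathbb R$. For $l>0$ consider bosons in the periodic box of side $l$ and volume $V=l^d$ in $\mathbb R^d$, with momenta $\mathbf p\in\Lambda_l^*=(2\pi/l)\mathbb Z^d$ and one-particle energies $\lambda_l(\mathbf p)=\mathbf p^2/2$. On the bosonic Fock space over these modes let $a_{\mathbf p}^\dagger,a_{\mathbf p}$ be the creation and annihilation operators, $\hat n_{\mathbf p}=a_{\mathbf p}^\dagger a_{\mathbf p}$ and $\hat N=\sum_{\mathbf p}\hat n_{\mathbf p}$, and let $$H^{\rm id}_l(\mu)=\sum_{\mathbf p\in\Lambda_l^*}\lambda_l(\mathbf p)\,a_{\mathbf p}^\dagger a_{\mathbf p}-\mu\hat N-\nu\sqrt V\left(e^{i\varphi}a_{\mathbf 0}^\dagger+e^{-i\varphi}a_{\mathbf 0}\right),$$ $$H^{\rm app}_l(\mu)=\sum_{\mathbf p\in\Lambda_l^*}\lambda_l(\mathbf p)\,a_{\mathbf p}^\dagger a_{\mathbf p}-\mu\hat N-2\nu\sqrt V\sqrt{\hat n_{\mathbf 0}+1}.$$ For either model and inverse temperature $\beta>0$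 let $\Xi_l={\rm Tr}\,e^{-\beta H_l(\mu)}$, let $p_l=(\beta V)^{-1}\ln\Xi_l$ be the pressure, and let $\langle\hat n_{\mathbf 0}\rangle_l=\Xi_l^{-1}\,{\rm Tr}\left(\hat n_{\mathbf 0}e^{-\beta H_l(\mu)}\right)$. The condensate density is $\rho_{\mathbf 0}=\lim_{l\to\infty}\langle\hat n_{\mathbf 0}\rangle_l/V$. A model undergoes non-conventional condensation (for the given $\mu,\nu$, and $\varphi$) if $\rho_{\mathbf 0}$ exists for every $\beta>0$, is strictly positive, and does not depend on $\beta$. For all $\beta>0$ and $l>0$ these quantities are well defined and finite for both models. Moreover: 1. for every $\beta>0$ the limit pressures $p^{\rm id}=\lim_{l\to\infty}p^{\rm id}_l$ and $p^{\rm app}=\lim_{l\to\infty}p^{\rm app}_l$ exist, are finite, and $p^{\rm id}=p^{\rm app}$; 2. the model $H^{\rm app}$ undergoes non-conventional condensation if and only if the model $H^{\rm id}$ does, and both do; 3. for every $\beta>0$ the condensate densities are $\rho^{\rm app}_{\mathbf 0}=\rho^{\rm id}_{\mathbf 0}=\nu^2/\mu^2$. -/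

import Mathlib

open Filter Topology

noncomputable section

namespace BoseGas

/-- A mode is labelled by `k ∈ ℤ^d`; in the periodic box of side `l` it carries the momentum
`p = 2πk/l`. -/
abbrev Mode (d : ℕ) : Type := Fin d → ℤ

/-- Occupation-number configurations: finitely many particles distributed over the modes. -/
abbrev Config (d : ℕ) : Type := Mode d →₀ ℕ

/-- The bosonic Fock space over the modes, in the occupation-number representation:
the square-summable functions of the occupation numbers. -/
abbrev Fock (d : ℕ) : Type := lp (fun _ : Config d => ℂ) 2

/-- The normalized occupation-number state `|n⟩`. -/
def ket {d : ℕ} (n : Config d) : Fock d := lp.single 2 n (1 : ℂ)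

/-- The operator `(A ψ)(n) = c n * ψ (σ n)` on its maximal domain, the set of all `ψ` in the Fock
space for which the right-hand side is square-summable. -/
def weightedOp {d : ℕ} (c : Config d → ℝ) (σ : Config d → Config d) : Fock d →ₗ.[ℂ] Fock d where
  domain :=
    { carrier := {ψ | Memℓp (fun n => (c n : ℂ) * ψ (σ n)) 2}
      zero_mem' := by
        have h : (fun n => (c n : ℂ) * (0 : Fock d) (σ n)) = (0 : Config d → ℂ) := by
          funext n; simp
        show Memℓp (fun n => (c n : ℂ) * (0 : Fock d) (σ n)) 2
        rw [h]; exact zero_memℓp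
      add_mem' := by
        intro ψ χ hψ hχ
        have h : (fun n => (c n : ℂ) * (ψ + χ) (σ n))
            = (fun n => (c n : ℂ) * ψ (σ n)) + fun n => (c n : ℂ) * χ (σ n) := by
          funext n; simp [mul_add]
        show Memℓp (fun n => (c n : ℂ) * (ψ + χ) (σ n)) 2
        rw [h]; exact Memℓp.add hψ hχ
      smul_mem' := by
        intro z ψ hψ
        have h : (fun n => (c n : ℂ) * (z • ψ) (σ n))
            = z • fun n => (c n : ℂ) * ψ (σ n) := by
          funext n; simp [mul_left_comm]
        show Memℓp (fun n => (c n : ℂ) * (z • ψ) (σ n)) 2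
        rw [h]; exact Memℓp.const_smul hψ z }
  toFun :=
    { toFun := fun ψ => ⟨fun n => (c n : ℂ) * (ψ : Fock d) (σ n), ψ.2⟩
      map_add' := by
        intro ψ χ
        ext n
        exact mul_add _ _ _
      map_smul' := by
        intro z ψ
        ext n
        simp [mul_left_comm] }

/-- The annihilation operator: `a_k |n⟩ = √(n_k) |n - δ_k⟩`, that is
`(a_k ψ)(n) = √(n_k + 1) ψ(n + δ_k)`. -/
def annihilation {d : ℕ} (k : Mode d) : Fock d →ₗ.[ℂ] Fock d :=
  weightedOp (fun n => Real.sqrt (n k + 1)) (fun n => n + Finsupp.single k 1)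

/-- The creation operator: `a_k† |n⟩ = √(n_k + 1) |n + δ_k⟩`, that is
`(a_k† ψ)(n) = √(n_k) ψ(n - δ_k)`, read as `0` if `n_k = 0`. -/
def creation {d : ℕ} (k : Mode d) : Fock d →ₗ.[ℂ] Fock d :=
  weightedOp (fun n => Real.sqrt (n k)) (fun n => n - Finsupp.single k 1)

/-- The operator `f(n̂)` for a real function `f` of the occupation numbers. -/
def diagonal {d : ℕ} (f : Config d → ℝ) : Fock d →ₗ.[ℂ] Fock d :=
  weightedOp f id

/-- The one-particle energy `λ_l(p) = p² / 2` of the mode with momentum `p = 2πk/l`. -/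
def modeEnergy {d : ℕ} (l : ℝ) (k : Mode d) : ℝ :=
  (∑ i, (2 * Real.pi * (k i : ℝ) / l) ^ 2) / 2

/-- The kinetic energy `∑_p λ_l(p) n̂_p`. -/
def kineticEnergy (d : ℕ) (l : ℝ) : Fock d →ₗ.[ℂ] Fock d :=
  diagonal fun n => n.sum fun k m => modeEnergy l k * (m : ℝ)

/-- The total number operator `N̂ = ∑_p n̂_p`. -/
def totalNumber (d : ℕ) : Fock d →ₗ.[ℂ] Fock d :=
  diagonal fun n => n.sum fun _ m => (m : ℝ)

/-- The volume `V = l^d` of the box. -/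
def volume (d : ℕ) (l : ℝ) : ℝ := l ^ d

/-- The ideal Bose gas with the linear source that breaks the `U(1)` symmetry:
`∑_p λ_l(p) a_p† a_p - μ N̂ - ν √V (e^{iφ} a_0† + e^{-iφ} a_0)`. -/
def idealHamiltonian (d : ℕ) (μ ν φ l : ℝ) : Fock d →ₗ.[ℂ] Fock d :=
  kineticEnergy d l - (μ : ℂ) • totalNumber d
    - ((ν * Real.sqrt (volume d l) : ℝ) : ℂ) •
      (Complex.exp (Complex.I * φ) • creation (0 : Mode d)
        + Complex.exp (-(Complex.I * φ)) • annihilation (0 : Mode d))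

/-- The ideal Bose gas with the nonlinear gauge-invariant perturbation:
`∑_p λ_l(p) a_p† a_p - 2 ν √V √(n̂_0 + 1) - μ N̂`. -/
def appHamiltonian (d : ℕ) (μ ν l : ℝ) : Fock d →ₗ.[ℂ] Fock d :=
  kineticEnergy d l
    - ((2 * ν * Real.sqrt (volume d l) : ℝ) : ℂ) •
      diagonal (fun n : Config d => Real.sqrt (n 0 + 1))
    - (μ : ℂ) • totalNumber d

/-- `T = exp(-β H)` in the sense of the functional calculus, for a self-adjoint operator `H` with an
orthonormal basis of eigenvectors. These are all the self-adjoint operators that matter for the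
grand canonical ensemble: if `exp(-β H)` is of trace class with `β > 0`, such a basis exists.
There is at most one such `T`, since the eigenspaces of a self-adjoint operator to different
eigenvalues are orthogonal. -/
def IsBoltzmannOperator {d : ℕ} (H : Fock d →ₗ.[ℂ] Fock d) (β : ℝ) (T : Fock d →L[ℂ] Fock d) :
    Prop :=
  IsSelfAdjoint H ∧
    ∃ (ι : Type) (b : HilbertBasis ι ℂ (Fock d)) (E : ι → ℝ), ∀ i,
      (∃ h : b i ∈ H.domain, H ⟨b i, h⟩ = (E i : ℂ) • b i) ∧
        T (b i) = (Real.exp (-β * E i) : ℂ) • b i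

open Classical in
/-- The operator `exp(-β H)`, with the value `0` if it does not exist. -/
def boltzmann {d : ℕ} (H : Fock d →ₗ.[ℂ] Fock d) (β : ℝ) : Fock d →L[ℂ] Fock d :=
  if h : ∃ T, IsBoltzmannOperator H β T then h.choose else 0

/-- The diagonal matrix element `⟨n| exp(-β H) |n⟩`. -/
def weight {d : ℕ} (H : Fock d →ₗ.[ℂ] Fock d) (β : ℝ) (n : Config d) : ℝ :=
  (inner ℂ (ket n) (boltzmann H β (ket n))).re

/-- The grand canonical partition function `Ξ = Tr exp(-β H)`. -/
def partitionFunction {d : ℕ} (H : Fock d →ₗ.[ℂ] Fock d) (β : ℝ) : ℝ :=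
  ∑' n, weight H β n

/-- The thermal average `⟨n̂_0⟩ = Ξ⁻¹ Tr (n̂_0 exp(-β H))` of the occupation of the zero mode. -/
def zeroModeOccupation {d : ℕ} (H : Fock d →ₗ.[ℂ] Fock d) (β : ℝ) : ℝ :=
  (∑' n : Config d, (n 0 : ℝ) * weight H β n) / partitionFunction H β

/-- The Gibbs state of `H` at inverse temperature `β` exists: `exp(-β H)` exists, its trace is finite
and nonzero, and the mean occupation of the zero mode is finite. -/
def HasGibbsState {d : ℕ} (H : Fock d →ₗ.[ℂ] Fock d) (β : ℝ) : Prop :=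
  (∃ T, IsBoltzmannOperator H β T) ∧ Summable (weight H β) ∧ 0 < partitionFunction H β ∧
    Summable fun n : Config d => (n 0 : ℝ) * weight H β n

/-- The finite-volume pressure `p_l = (β V)⁻¹ ln Ξ`; here `H l` is the Hamiltonian, the term
`-μ N̂` included, in the box of side `l`. -/
def pressure {d : ℕ} (H : ℝ → Fock d →ₗ.[ℂ] Fock d) (β l : ℝ) : ℝ :=
  Real.log (partitionFunction (H l) β) / (β * volume d l)

/-- The condensate density is `ρ₀` at inverse temperature `β`: in the thermodynamic limit
`⟨n̂_0 / V⟩ → ρ₀`. -/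
def HasCondensateDensity {d : ℕ} (H : ℝ → Fock d →ₗ.[ℂ] Fock d) (β ρ₀ : ℝ) : Prop :=
  Tendsto (fun l => zeroModeOccupation (H l) β / volume d l) atTop (𝓝 ρ₀)

/-- Non-conventional condensation: the zero mode is macroscopically occupied, and the condensate
density does not depend on the temperature. -/
def NonConventionalCondensation {d : ℕ} (H : ℝ → Fock d →ₗ.[ℂ] Fock d) : Prop :=
  ∃ ρ₀ : ℝ, 0 < ρ₀ ∧ ∀ β : ℝ, 0 < β → HasCondensateDensity H β ρ₀

end BoseGas

end

/-! Both models differ from the free gas only in the zero mode, so the other modes contribute one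
common factor to every trace.

For the linear source, completing the square in the zero mode with κ = ν√V gives -μ a†a - κ(e^{iφ}a†
+ e^{-iφ}a) = -μ b†b - κ²/(-μ), where b is a shifted by a multiple of the identity of modulus a =
κ/(-μ). The eigenvectors are displaced number states, whose amplitudes are Charlier polynomials. The
spectrum is therefore the free one lowered by ν²V/(-μ), and the mean of n̂_0 in the m-th displaced
state is m + a² (`ideal_hasSum`). The pressure is the free pressure plus ν²/(-μ), and the occupation
is the free one, which is independent of V, plus ν²V/μ².

The nonlinear model is diagonal in the occupation numbers. Its zero mode has the one-dimensional
partition function ∑_j exp(s√(j+1) - γj), with γ = -βμ and s = 2βν√V. Laplace's method gives log Z ~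
s²/(4γ) as s → ∞ (`tendsto_log_modeSum_div_sq`). Since log Z is convex in γ, the limit may be
differentiated, so the mean is ~ s²/(4γ²) (`tendsto_modeMean_div_sq`). Substituting s² = 4β²ν²V
gives the same pressure shift ν²/(-μ) and the same density ν²/μ², from which β has cancelled.

The operator theory makes these traces legitimate. Both operators are self-adjoint on their natural
domains because μ < 0 lets the free energy dominate the source. Both have complete orthonormal
eigenbases, and `Diagonalizes.hasSum_mul_weight` computes the traces in them. What remains is the
free pressure limit: the cycle expansion of the partition function with Poisson summation
(`exists_tendsto_freeLogPartition`). -/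

noncomputable section

namespace BoseGas

variable {d : ℕ}

/-! ### Square-summability, ladder operators and a self-adjointness criterion -/

theorem memℓp_two_of_norm_le {ι : Type*} {f g : ι → ℂ} (hg : Memℓp g 2)
    (h : ∀ i, ‖f i‖ ≤ ‖g i‖) : Memℓp f 2 := by
  rw [memℓp_gen_iff (by simp)] at hg ⊢
  refine hg.of_nonneg_of_le (fun i => by positivity) fun i => ?_
  have := h i
  gcongr

theorem memℓp_two_comp_injective {ι κ : Type*} {f : ι → ℂ} (hf : Memℓp f 2) {σ : κ → ι}
    (hσ : Function.Injective σ) : Memℓp (fun i => f (σ i)) 2 := by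
  rw [memℓp_gen_iff (by simp)] at hf ⊢
  exact hf.comp_injective hσ

theorem memℓp_two_iff_of_injective {ι κ : Type*} {f : ι → ℂ} {σ : κ → ι}
    (hσ : Function.Injective σ) (h0 : ∀ i, i ∉ Set.range σ → f i = 0) :
    Memℓp (fun i => f (σ i)) 2 ↔ Memℓp f 2 := by
  rw [memℓp_gen_iff (by simp), memℓp_gen_iff (by simp)]
  refine hσ.summable_iff (f := fun i => ‖f i‖ ^ (2 : ENNReal).toReal) fun i hi => ?_
  simp [h0 i hi]

theorem ket_apply (n m : Config d) : (ket n : Fock d) m = if m = n then 1 else 0 := by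
  classical
  by_cases h : m = n
  · subst h; simp [ket]
  · simp [ket, h]

theorem inner_ket_left (n : Config d) (ψ : Fock d) : inner ℂ (ket n) ψ = ψ n := by
  simp [ket, lp.inner_single_left]

theorem inner_ket_right (n : Config d) (ψ : Fock d) :
    inner ℂ ψ (ket n) = starRingEnd ℂ (ψ n) := by
  rw [← inner_conj_symm, inner_ket_left]

theorem norm_ket (n : Config d) : ‖(ket n : Fock d)‖ = 1 := by
  simp [ket]

theorem mem_weightedOp_domain {c : Config d → ℝ} {σ : Config d → Config d} {ψ : Fock d} :
    ψ ∈ (weightedOp c σ).domain ↔ Memℓp (fun n => (c n : ℂ) * ψ (σ n)) 2 := Iff.rfl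

theorem diagonal_apply (f : Config d → ℝ) (ψ : (diagonal f).domain) (n : Config d) :
    (diagonal f ψ) n = (f n : ℂ) * (ψ : Fock d) n := rfl

theorem mem_diagonal_domain {f : Config d → ℝ} {ψ : Fock d} :
    ψ ∈ (diagonal f).domain ↔ Memℓp (fun n => (f n : ℂ) * ψ n) 2 := Iff.rfl

theorem diagonal_isFormalAdjoint (f : Config d → ℝ) :
    (diagonal f).IsFormalAdjoint (diagonal f) := by
  intro x y
  rw [lp.inner_eq_tsum, lp.inner_eq_tsum]
  refine tsum_congr fun n => ?_
  simp only [diagonal_apply, RCLike.inner_apply, map_mul, Complex.conj_ofReal]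
  ring

theorem notMem_range_add_single {k : Mode d} {n : Config d}
    (h : n ∉ Set.range fun m : Config d => m + Finsupp.single k 1) : n k = 0 := by
  by_contra h0
  refine h ⟨n - Finsupp.single k 1, ?_⟩
  exact tsub_add_cancel_of_le (Finsupp.single_le_iff.2 (Nat.one_le_iff_ne_zero.2 h0))

theorem creation_apply (k : Mode d) (ψ : (creation k).domain) (n : Config d) :
    (creation k ψ) n = (Real.sqrt (n k) : ℂ) * (ψ : Fock d) (n - Finsupp.single k 1) := rfl

theorem annihilation_apply (k : Mode d) (ψ : (annihilation k).domain) (n : Config d) :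
    (annihilation k ψ) n = (Real.sqrt (n k + 1) : ℂ) * (ψ : Fock d) (n + Finsupp.single k 1) := rfl

theorem creation_isFormalAdjoint (k : Mode d) :
    (creation k).IsFormalAdjoint (annihilation k) := by
  intro x y
  rw [lp.inner_eq_tsum, lp.inner_eq_tsum]
  rw [← (add_left_injective (Finsupp.single k 1)).tsum_eq]
  · refine tsum_congr fun n => ?_
    simp only [creation_apply, annihilation_apply, RCLike.inner_apply, map_mul,
      Complex.conj_ofReal, add_tsub_cancel_right, Finsupp.add_apply, Finsupp.single_eq_same,
      Nat.cast_add, Nat.cast_one]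
    ring
  · intro n hn
    by_contra h
    apply hn
    simp [creation_apply, notMem_range_add_single h]

/-- Reindexing by one added particle turns the weight √(n_k) into √(n_k + 1); the configurations
missed by the shift have n_k = 0 and so weight zero. -/
theorem mem_creation_domain_iff {k : Mode d} {ψ : Fock d} :
    ψ ∈ (creation k).domain ↔ Memℓp (fun n => (Real.sqrt (n k + 1) : ℂ) * ψ n) 2 := by
  have h := memℓp_two_iff_of_injective (add_left_injective (Finsupp.single k 1))
    (f := fun n : Config d => (Real.sqrt (n k) : ℂ) * ψ (n - Finsupp.single k 1)) fun n hn => by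
      simp [notMem_range_add_single hn]
  simp only [add_tsub_cancel_right, Finsupp.add_apply, Finsupp.single_eq_same,
      Nat.cast_add, Nat.cast_one] at h
  exact h.symm

theorem mem_annihilation_domain_of_mem_creation_domain {k : Mode d} {ψ : Fock d}
    (h : ψ ∈ (creation k).domain) : ψ ∈ (annihilation k).domain := by
  rw [mem_creation_domain_iff] at h
  refine memℓp_two_of_norm_le
    (memℓp_two_comp_injective h (add_left_injective (Finsupp.single k 1))) fun n => ?_
  simp only [norm_mul, Complex.norm_real, Real.norm_eq_abs, abs_of_nonneg (Real.sqrt_nonneg _),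
    Finsupp.add_apply, Finsupp.single_eq_same, Nat.cast_add, Nat.cast_one]
  gcongr
  linarith

/-- The kets span a dense subspace of the domain, so symmetry gives H ≤ H†. If ψ lies in the domain
of H†, then pairing with the vectors H|n⟩ yields the coefficients of H†ψ, and `hreg` is the
regularity statement that puts such a ψ back into the domain of H. -/
theorem isSelfAdjoint_of_ket_mem (H : Fock d →ₗ.[ℂ] Fock d) (hsymm : H.IsFormalAdjoint H)
    (hket : ∀ n, ket n ∈ H.domain)
    (hreg : ∀ ψ η : Fock d, (∀ n, inner ℂ (H ⟨ket n, hket n⟩) ψ = η n) → ψ ∈ H.domain) :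
    IsSelfAdjoint H := by
  classical
  have hd : Dense (H.domain : Set (Fock d)) := by
    intro ψ
    have h := lp.hasSum_single (E := fun _ : Config d => ℂ) (p := 2) (by simp) ψ
    refine mem_closure_of_tendsto h (Eventually.of_forall fun s => ?_)
    refine Submodule.sum_mem _ fun n _ => ?_
    have : lp.single 2 n (ψ n) = ψ n • (ket n : Fock d) := by
      rw [ket, ← lp.single_smul]; simp
    exact this ▸ Submodule.smul_mem _ _ (hket n)
  rw [LinearPMap.isSelfAdjoint_def]
  refine (LinearPMap.eq_of_le_of_domain_eq (hsymm.le_adjoint hd) ?_).symm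
  refine le_antisymm (hsymm.le_adjoint hd).1 fun ψ hψ => ?_
  refine hreg ψ (H.adjoint ⟨ψ, hψ⟩) fun n => ?_
  have h := LinearPMap.adjoint_isFormalAdjoint hd ⟨ψ, hψ⟩ ⟨ket n, hket n⟩
  rw [← inner_conj_symm, ← h, inner_conj_symm, inner_ket_left]

/-! ### Free energy and its domination of the kinetic and number operators -/

/-- The eigenvalue `∑_p (λ_l(p) - μ) n_p` of the free grand canonical Hamiltonian. -/
def freeEnergy (d : ℕ) (μ l : ℝ) (n : Config d) : ℝ :=
  n.sum fun k m => (modeEnergy l k - μ) * (m : ℝ)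

theorem modeEnergy_nonneg (l : ℝ) (k : Mode d) : 0 ≤ modeEnergy l k := by
  unfold modeEnergy; positivity

theorem modeEnergy_zero (l : ℝ) : modeEnergy l (0 : Mode d) = 0 := by
  simp [modeEnergy]

theorem freeEnergy_eq (μ l : ℝ) (n : Config d) :
    freeEnergy d μ l n = (n.sum fun k m => modeEnergy l k * (m : ℝ))
      - μ * n.sum fun _ m => (m : ℝ) := by
  simp only [freeEnergy, Finsupp.sum, Finset.mul_sum, ← Finset.sum_sub_distrib]
  exact Finset.sum_congr rfl fun _ _ => by ring

theorem kinetic_nonneg (l : ℝ) (n : Config d) :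
    0 ≤ n.sum fun k m => modeEnergy l k * (m : ℝ) :=
  Finset.sum_nonneg fun k _ => mul_nonneg (modeEnergy_nonneg l k) (Nat.cast_nonneg _)

theorem number_nonneg (n : Config d) : 0 ≤ n.sum fun _ m => (m : ℝ) :=
  Finset.sum_nonneg fun _ _ => Nat.cast_nonneg _

theorem zeroMode_le_number (n : Config d) : (n 0 : ℝ) ≤ n.sum fun _ m => (m : ℝ) := by
  by_cases h : n 0 = 0
  · simpa [h] using number_nonneg n
  · exact Finset.single_le_sum (f := fun k => (n k : ℝ)) (fun _ _ => Nat.cast_nonneg _)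
      (Finsupp.mem_support_iff.2 h)

theorem kinetic_le_freeEnergy {μ : ℝ} (hμ : μ < 0) (l : ℝ) (n : Config d) :
    (n.sum fun k m => modeEnergy l k * (m : ℝ)) ≤ freeEnergy d μ l n := by
  have := number_nonneg n
  rw [freeEnergy_eq]; nlinarith

theorem number_le_freeEnergy {μ : ℝ} (l : ℝ) (n : Config d) :
    (-μ) * (n.sum fun _ m => (m : ℝ)) ≤ freeEnergy d μ l n := by
  have := kinetic_nonneg l n
  rw [freeEnergy_eq]; linarith

theorem zeroMode_le_freeEnergy {μ : ℝ} (hμ : μ < 0) (l : ℝ) (n : Config d) :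
    (-μ) * (n 0 : ℝ) ≤ freeEnergy d μ l n :=
  (mul_le_mul_of_nonneg_left (zeroMode_le_number n) (by linarith)).trans
    (number_le_freeEnergy l n)

theorem freeEnergy_nonneg {μ : ℝ} (hμ : μ < 0) (l : ℝ) (n : Config d) :
    0 ≤ freeEnergy d μ l n :=
  (kinetic_nonneg l n).trans (kinetic_le_freeEnergy hμ l n)

theorem memℓp_real_mul_of_abs_le {f g : Config d → ℝ} {ψ : Config d → ℂ}
    (hg : Memℓp (fun n => (g n : ℂ) * ψ n) 2) (h : ∀ n, |f n| ≤ |g n|) :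
    Memℓp (fun n => (f n : ℂ) * ψ n) 2 := by
  refine memℓp_two_of_norm_le hg fun n => ?_
  simp only [norm_mul, Complex.norm_real, Real.norm_eq_abs]
  exact mul_le_mul_of_nonneg_right (h n) (norm_nonneg _)

theorem memℓp_const_mul {f : Config d → ℂ} (hf : Memℓp f 2) (z : ℂ) :
    Memℓp (fun n => z * f n) 2 := hf.const_smul z

/-- For μ < 0 the kinetic part and -μN̂ are both nonnegative, so no cancellation can occur and each
is bounded by their sum. -/
theorem memℓp_freeEnergy_mul {μ : ℝ} (hμ : μ < 0) (l : ℝ) {ψ : Fock d}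
    (h : Memℓp (fun n => (freeEnergy d μ l n : ℂ) * ψ n) 2) :
    ψ ∈ (kineticEnergy d l).domain ∧ ψ ∈ (totalNumber d).domain := by
  refine ⟨mem_diagonal_domain.2 (memℓp_real_mul_of_abs_le h fun n => ?_),
    mem_diagonal_domain.2 (memℓp_real_mul_of_abs_le
      (g := fun n => (-μ)⁻¹ * freeEnergy d μ l n) ?_ fun n => ?_)⟩
  · exact abs_le_abs_of_nonneg (kinetic_nonneg l n) (kinetic_le_freeEnergy hμ l n)
  · simpa only [Complex.ofReal_mul, mul_assoc] using memℓp_const_mul h ((-μ)⁻¹ : ℝ)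
  · refine abs_le_abs_of_nonneg (number_nonneg n) ?_
    rw [le_inv_mul_iff₀ (by linarith)]
    exact number_le_freeEnergy l n

theorem memℓp_mul_ket (c : Config d → ℂ) (n : Config d) :
    Memℓp (fun m => c m * (ket n : Fock d) m) 2 := by
  refine memℓp_two_of_norm_le (lp.memℓp (c n • (ket n : Fock d))) fun m => ?_
  by_cases h : m = n
  · subst h; simp
  · simp [ket_apply, h]

theorem ket_mem_diagonal (f : Config d → ℝ) (n : Config d) : ket n ∈ (diagonal f).domain :=
  mem_diagonal_domain.2 (memℓp_mul_ket _ n)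

theorem ket_mem_creation (k : Mode d) (n : Config d) : ket n ∈ (creation k).domain :=
  mem_creation_domain_iff.2 (memℓp_mul_ket _ n)

theorem ket_mem_annihilation (k : Mode d) (n : Config d) : ket n ∈ (annihilation k).domain :=
  mem_annihilation_domain_of_mem_creation_domain (ket_mem_creation k n)

theorem diagonal_ket (f : Config d → ℝ) (n : Config d) (h : ket n ∈ (diagonal f).domain) :
    diagonal f ⟨ket n, h⟩ = (f n : ℂ) • ket n := by
  ext m
  by_cases hm : m = n
  · subst hm; simp [diagonal_apply, -Complex.coe_smul]
  · simp [diagonal_apply, ket_apply, hm, -Complex.coe_smul]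

theorem kineticEnergy_apply (l : ℝ) (ψ : (kineticEnergy d l).domain) (n : Config d) :
    (kineticEnergy d l ψ) n =
      ((n.sum fun k m => modeEnergy l k * (m : ℝ) : ℝ) : ℂ) * (ψ : Fock d) n := rfl

theorem totalNumber_apply (ψ : (totalNumber d).domain) (n : Config d) :
    (totalNumber d ψ) n = ((n.sum fun _ m => (m : ℝ) : ℝ) : ℂ) * (ψ : Fock d) n := rfl

theorem kineticEnergy_ket (l : ℝ) (n : Config d) (h : ket n ∈ (kineticEnergy d l).domain) :
    kineticEnergy d l ⟨ket n, h⟩ =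
      ((n.sum fun k m => modeEnergy l k * (m : ℝ) : ℝ) : ℂ) • ket n := diagonal_ket _ n h

theorem totalNumber_ket (n : Config d) (h : ket n ∈ (totalNumber d).domain) :
    totalNumber d ⟨ket n, h⟩ = ((n.sum fun _ m => (m : ℝ) : ℝ) : ℂ) • ket n :=
  diagonal_ket _ n h

theorem creation_ket (k : Mode d) (n : Config d) (h : ket n ∈ (creation k).domain) :
    creation k ⟨ket n, h⟩ = (Real.sqrt (n k + 1) : ℂ) • ket (n + Finsupp.single k 1) := by
  ext m
  by_cases hm : m ∈ Set.range fun m : Config d => m + Finsupp.single k 1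
  · obtain ⟨m, rfl⟩ := hm
    by_cases hmn : m = n
    · subst hmn; simp [creation_apply, ket_apply, -Complex.coe_smul]
    · simp [creation_apply, ket_apply, hmn, -Complex.coe_smul]
  · have h1 : m ≠ n + Finsupp.single k 1 := fun h => hm ⟨n, h.symm⟩
    simp [creation_apply, ket_apply, notMem_range_add_single hm, h1, -Complex.coe_smul]

theorem annihilation_ket (k : Mode d) (n : Config d) (h : ket n ∈ (annihilation k).domain) :
    annihilation k ⟨ket n, h⟩ = (Real.sqrt (n k) : ℂ) • ket (n - Finsupp.single k 1) := by
  ext m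
  by_cases hn : n ∈ Set.range fun m : Config d => m + Finsupp.single k 1
  · obtain ⟨n, rfl⟩ := hn
    by_cases hmn : m = n
    · subst hmn; simp [annihilation_apply, ket_apply, -Complex.coe_smul]
    · simp [annihilation_apply, ket_apply, hmn, -Complex.coe_smul]
  · have h1 : m + Finsupp.single k 1 ≠ n := fun h => hn ⟨m, h⟩
    simp [annihilation_apply, ket_apply, notMem_range_add_single hn, h1, -Complex.coe_smul]

/-! ### The two Hamiltonians: coordinates and self-adjointness -/

theorem mem_idealHamiltonian_domain {μ ν φ l : ℝ} {ψ : Fock d} :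
    ψ ∈ (idealHamiltonian d μ ν φ l).domain ↔
      (ψ ∈ (kineticEnergy d l).domain ∧ ψ ∈ (totalNumber d).domain) ∧
        ψ ∈ (creation (0 : Mode d)).domain ∧ ψ ∈ (annihilation (0 : Mode d)).domain := Iff.rfl

theorem idealHamiltonian_eq {μ ν φ l : ℝ} {ψ : Fock d}
    (h : ψ ∈ (idealHamiltonian d μ ν φ l).domain) :
    idealHamiltonian d μ ν φ l ⟨ψ, h⟩ = kineticEnergy d l ⟨ψ, h.1.1⟩
      - (μ : ℂ) • totalNumber d ⟨ψ, h.1.2⟩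
      - ((ν * Real.sqrt (volume d l) : ℝ) : ℂ) •
        (Complex.exp (Complex.I * φ) • creation (0 : Mode d) ⟨ψ, h.2.1⟩
          + Complex.exp (-(Complex.I * φ)) • annihilation (0 : Mode d) ⟨ψ, h.2.2⟩) := rfl

theorem mem_appHamiltonian_domain {μ ν l : ℝ} {ψ : Fock d} :
    ψ ∈ (appHamiltonian d μ ν l).domain ↔
      (ψ ∈ (kineticEnergy d l).domain ∧
        ψ ∈ (diagonal fun n : Config d => Real.sqrt (n 0 + 1)).domain) ∧
          ψ ∈ (totalNumber d).domain := Iff.rfl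

theorem appHamiltonian_eq {μ ν l : ℝ} {ψ : Fock d}
    (h : ψ ∈ (appHamiltonian d μ ν l).domain) :
    appHamiltonian d μ ν l ⟨ψ, h⟩ = kineticEnergy d l ⟨ψ, h.1.1⟩
      - ((2 * ν * Real.sqrt (volume d l) : ℝ) : ℂ) •
        diagonal (fun n : Config d => Real.sqrt (n 0 + 1)) ⟨ψ, h.1.2⟩
      - (μ : ℂ) • totalNumber d ⟨ψ, h.2⟩ := rfl

theorem ket_mem_idealHamiltonian (μ ν φ l : ℝ) (n : Config d) :
    ket n ∈ (idealHamiltonian d μ ν φ l).domain :=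
  ⟨⟨ket_mem_diagonal _ n, ket_mem_diagonal _ n⟩, ket_mem_creation _ n, ket_mem_annihilation _ n⟩

theorem ket_mem_appHamiltonian (μ ν l : ℝ) (n : Config d) :
    ket n ∈ (appHamiltonian d μ ν l).domain :=
  ⟨⟨ket_mem_diagonal _ n, ket_mem_diagonal _ n⟩, ket_mem_diagonal _ n⟩

theorem idealHamiltonian_apply {μ ν φ l : ℝ} {ψ : Fock d}
    (h : ψ ∈ (idealHamiltonian d μ ν φ l).domain) (n : Config d) :
    idealHamiltonian d μ ν φ l ⟨ψ, h⟩ n = (freeEnergy d μ l n : ℂ) * ψ n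
      - ((ν * Real.sqrt (volume d l) : ℝ) : ℂ) *
        (Complex.exp (Complex.I * φ) * ((Real.sqrt (n 0) : ℂ) * ψ (n - Finsupp.single 0 1))
          + Complex.exp (-(Complex.I * φ)) *
            ((Real.sqrt (n 0 + 1) : ℂ) * ψ (n + Finsupp.single 0 1))) := by
  rw [idealHamiltonian_eq, freeEnergy_eq]
  simp only [lp.coeFn_sub, lp.coeFn_smul, lp.coeFn_add, Pi.sub_apply, Pi.smul_apply, Pi.add_apply,
    smul_eq_mul, creation_apply, annihilation_apply]
  rw [kineticEnergy_apply, totalNumber_apply]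
  push_cast
  ring

theorem appHamiltonian_apply {μ ν l : ℝ} {ψ : Fock d}
    (h : ψ ∈ (appHamiltonian d μ ν l).domain) (n : Config d) :
    appHamiltonian d μ ν l ⟨ψ, h⟩ n = ((freeEnergy d μ l n
      - 2 * ν * Real.sqrt (volume d l) * Real.sqrt (n 0 + 1) : ℝ) : ℂ) * ψ n := by
  rw [appHamiltonian_eq, freeEnergy_eq]
  simp only [lp.coeFn_sub, lp.coeFn_smul, Pi.sub_apply, Pi.smul_apply, smul_eq_mul, diagonal_apply]
  rw [kineticEnergy_apply, totalNumber_apply]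
  push_cast
  ring

theorem inner_idealHamiltonian_ket {μ ν φ l : ℝ} (n : Config d) (ψ : Fock d)
    (h : ket n ∈ (idealHamiltonian d μ ν φ l).domain) :
    inner ℂ (idealHamiltonian d μ ν φ l ⟨ket n, h⟩) ψ = (freeEnergy d μ l n : ℂ) * ψ n
      - ((ν * Real.sqrt (volume d l) : ℝ) : ℂ) *
        (Complex.exp (Complex.I * φ) * ((Real.sqrt (n 0) : ℂ) * ψ (n - Finsupp.single 0 1))
          + Complex.exp (-(Complex.I * φ)) *
            ((Real.sqrt (n 0 + 1) : ℂ) * ψ (n + Finsupp.single 0 1))) := by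
  rw [idealHamiltonian_eq, freeEnergy_eq, creation_ket, annihilation_ket,
    kineticEnergy_ket, totalNumber_ket]
  simp only [inner_sub_left, inner_add_left, inner_smul_left, inner_ket_left,
    Complex.conj_ofReal, ← Complex.exp_conj, map_neg, map_mul, Complex.conj_I, neg_mul, neg_neg]
  push_cast
  ring

/-- A two-step bootstrap. After division by √(n_0 + 1) the source terms are bounded, so E ψ/√(n_0 +
1) is square-summable, E being the free energy. Since n_0 ≤ E/(-μ), so is √(n_0 + 1) ψ, which puts ψ
in the domains of a_0† and a_0. Feeding this back into the equation gives E ψ ∈ ℓ². -/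
theorem mem_idealHamiltonian_domain_of_forall {μ ν φ l : ℝ} (hμ : μ < 0) {ψ η : Fock d}
    (h : ∀ n, (freeEnergy d μ l n : ℂ) * ψ n
      - ((ν * Real.sqrt (volume d l) : ℝ) : ℂ) *
        (Complex.exp (Complex.I * φ) * ((Real.sqrt (n 0) : ℂ) * ψ (n - Finsupp.single 0 1))
          + Complex.exp (-(Complex.I * φ)) *
            ((Real.sqrt (n 0 + 1) : ℂ) * ψ (n + Finsupp.single 0 1))) = η n) :
    ψ ∈ (idealHamiltonian d μ ν φ l).domain := by
  set κ : ℝ := ν * Real.sqrt (volume d l)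
  have hinv : ∀ n : Config d, |(Real.sqrt (n 0 + 1))⁻¹| ≤ |(1 : ℝ)| := fun n => by
    rw [abs_of_nonneg (by positivity), abs_one]
    exact inv_le_one_of_one_le₀ (Real.one_le_sqrt.2 (by linarith [Nat.cast_nonneg (α := ℝ) (n 0)]))
  have h1 (χ : Fock d) : Memℓp (fun n => (((Real.sqrt (n 0 + 1))⁻¹ : ℝ) : ℂ) * χ n) 2 :=
    memℓp_real_mul_of_abs_le (g := fun _ => 1) (by simpa using lp.memℓp χ) hinv
  have hshift : Memℓp (fun n : Config d => (((Real.sqrt (n 0 + 1))⁻¹ : ℝ) : ℂ) *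
      ((Real.sqrt (n 0) : ℂ) * ψ (n - Finsupp.single 0 1))) 2 := by
    rw [← memℓp_two_iff_of_injective (add_left_injective (Finsupp.single 0 1))
      (fun n hn => by simp [notMem_range_add_single hn])]
    refine memℓp_two_of_norm_le (lp.memℓp ψ) fun n => ?_
    simp only [add_tsub_cancel_right, Finsupp.add_apply, Finsupp.single_eq_same, Nat.cast_add,
      Nat.cast_one, norm_mul, Complex.norm_real, ← mul_assoc, Real.norm_eq_abs]
    refine mul_le_of_le_one_left (norm_nonneg _) ?_
    rw [abs_of_nonneg (by positivity), abs_of_nonneg (by positivity), inv_mul_le_one₀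
      (by positivity)]
    gcongr
    linarith
  have hshift' : Memℓp (fun n : Config d => ψ (n + Finsupp.single 0 1)) 2 :=
    memℓp_two_comp_injective (lp.memℓp ψ) (add_left_injective _)
  have hu : Memℓp (fun n : Config d =>
      ((freeEnergy d μ l n * (Real.sqrt (n 0 + 1))⁻¹ : ℝ) : ℂ) * ψ n) 2 := by
    have := (h1 η).add (memℓp_const_mul ((memℓp_const_mul hshift (Complex.exp (Complex.I * φ))).add
      (memℓp_const_mul hshift' (Complex.exp (-(Complex.I * φ))))) κ)
    convert this using 1
    funext n
    have hne : (Real.sqrt (n 0 + 1) : ℂ) ≠ 0 :=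
      Complex.ofReal_ne_zero.2 (Real.sqrt_ne_zero'.2 (by positivity))
    simp only [Pi.add_apply, ← h n]
    push_cast
    field_simp
    ring
  have hsqrt : ψ ∈ (creation (0 : Mode d)).domain := by
    rw [mem_creation_domain_iff]
    refine memℓp_real_mul_of_abs_le (f := fun n => Real.sqrt (n 0 + 1))
      (g := fun n => (-μ)⁻¹ * (freeEnergy d μ l n * (Real.sqrt (n 0 + 1))⁻¹)
        + (Real.sqrt (n 0 + 1))⁻¹) ?_ fun n => ?_
    · convert (memℓp_const_mul hu ((-μ)⁻¹ : ℝ)).add (h1 ψ) using 1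
      funext n
      simp only [Pi.add_apply]
      push_cast
      ring
    · refine abs_le_abs_of_nonneg (by positivity) ?_
      have hpos : 0 < Real.sqrt (n 0 + 1) := Real.sqrt_pos.2 (by positivity)
      have hz : (n 0 : ℝ) ≤ (-μ)⁻¹ * freeEnergy d μ l n := by
        rw [le_inv_mul_iff₀ (by linarith)]
        exact zeroMode_le_freeEnergy hμ l n
      calc Real.sqrt (n 0 + 1) = (n 0 + 1) * (Real.sqrt (n 0 + 1))⁻¹ := by
            rw [← div_eq_mul_inv, Real.div_sqrt]
        _ ≤ ((-μ)⁻¹ * freeEnergy d μ l n + 1) * (Real.sqrt (n 0 + 1))⁻¹ := by gcongr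
        _ = _ := by ring
  have hann := mem_annihilation_domain_of_mem_creation_domain hsqrt
  refine mem_idealHamiltonian_domain.2 ⟨memℓp_freeEnergy_mul hμ l ?_, hsqrt, hann⟩
  have := (lp.memℓp η).add (memℓp_const_mul
    ((memℓp_const_mul (mem_weightedOp_domain.1 hsqrt) (Complex.exp (Complex.I * φ))).add
      (memℓp_const_mul (mem_weightedOp_domain.1 hann) (Complex.exp (-(Complex.I * φ))))) κ)
  convert this using 1
  funext n
  simp only [Pi.add_apply, ← h n]
  ring

theorem mem_appHamiltonian_domain_of_forall {μ ν l : ℝ} (hμ : μ < 0) {ψ η : Fock d}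
    (h : ∀ n, ((freeEnergy d μ l n
      - 2 * ν * Real.sqrt (volume d l) * Real.sqrt (n 0 + 1) : ℝ) : ℂ) * ψ n = η n) :
    ψ ∈ (appHamiltonian d μ ν l).domain := by
  set c : ℝ := 2 * ν * Real.sqrt (volume d l)
  have hfree : Memℓp (fun n => (freeEnergy d μ l n : ℂ) * ψ n) 2 := by
    -- The constant is what 2xy ≤ x²/(-μ) + (-μ)y² leaves over with x = c, y = √(n_0 + 1), once
    -- (-μ)n_0 is absorbed in the free energy.
    refine memℓp_real_mul_of_abs_le (g := fun n => 2 * (freeEnergy d μ l n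
      - c * Real.sqrt (n 0 + 1)) + (c ^ 2 / (-μ) + (-μ))) ?_ fun n => ?_
    · convert (memℓp_const_mul (lp.memℓp η) 2).add
        (memℓp_const_mul (lp.memℓp ψ) ((c ^ 2 / (-μ) + (-μ) : ℝ) : ℂ)) using 1
      funext n
      simp only [Pi.add_apply, ← h n]
      push_cast
      ring
    · refine abs_le_abs_of_nonneg (freeEnergy_nonneg hμ l n) ?_
      have hz := zeroMode_le_freeEnergy hμ l n
      have hs : Real.sqrt (n 0 + 1) ^ 2 = n 0 + 1 := Real.sq_sqrt (by positivity)
      have hsq : 2 * (c * Real.sqrt (n 0 + 1)) ≤ c ^ 2 / (-μ) + (-μ) * Real.sqrt (n 0 + 1) ^ 2 := by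
        have : 0 ≤ (c - (-μ) * Real.sqrt (n 0 + 1)) ^ 2 / (-μ) := by
          apply div_nonneg (sq_nonneg _); linarith
        have hne : μ ≠ 0 := hμ.ne
        have e : (c - (-μ) * Real.sqrt (n 0 + 1)) ^ 2 / (-μ) =
          c ^ 2 / (-μ) - 2 * (c * Real.sqrt (n 0 + 1)) + (-μ) * Real.sqrt (n 0 + 1) ^ 2 := by
          field_simp
          ring
        linarith
      rw [hs] at hsq
      linarith
  obtain ⟨hK, hN⟩ := memℓp_freeEnergy_mul hμ l hfree
  refine mem_appHamiltonian_domain.2 ⟨⟨hK, mem_diagonal_domain.2 ?_⟩, hN⟩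
  refine memℓp_real_mul_of_abs_le (g := fun n => (-μ)⁻¹ * freeEnergy d μ l n + 1) ?_ fun n => ?_
  · convert (memℓp_const_mul hfree ((-μ)⁻¹ : ℝ)).add (lp.memℓp ψ) using 1
    funext n
    simp only [Pi.add_apply]
    push_cast
    ring
  · refine abs_le_abs_of_nonneg (by positivity) ?_
    have hz : (n 0 : ℝ) ≤ (-μ)⁻¹ * freeEnergy d μ l n := by
      rw [le_inv_mul_iff₀ (by linarith)]
      exact zeroMode_le_freeEnergy hμ l n
    refine le_trans (Real.sqrt_le_iff.2 ⟨by positivity, ?_⟩) (add_le_add_left hz 1)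
    nlinarith [Nat.cast_nonneg (α := ℝ) (n 0)]

theorem idealHamiltonian_isFormalAdjoint (μ ν φ l : ℝ) :
    (idealHamiltonian d μ ν φ l).IsFormalAdjoint (idealHamiltonian d μ ν φ l) := by
  rintro ⟨x, hx⟩ ⟨y, hy⟩
  rw [idealHamiltonian_eq hx, idealHamiltonian_eq hy]
  have h1 := diagonal_isFormalAdjoint _ ⟨x, hx.1.1⟩ ⟨y, hy.1.1⟩
  have h2 := diagonal_isFormalAdjoint _ ⟨x, hx.1.2⟩ ⟨y, hy.1.2⟩
  have h3 := creation_isFormalAdjoint 0 ⟨x, hx.2.1⟩ ⟨y, hy.2.2⟩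
  have h4 := (creation_isFormalAdjoint 0).symm ⟨x, hx.2.2⟩ ⟨y, hy.2.1⟩
  simp only [inner_sub_left, inner_add_left, inner_smul_left, inner_sub_right, inner_add_right,
    inner_smul_right, Complex.conj_ofReal, ← Complex.exp_conj, map_neg, map_mul, Complex.conj_I,
    neg_mul, neg_neg, kineticEnergy, totalNumber] at h1 h2 h3 h4 ⊢
  rw [h1, h2, h3, h4]
  ring

theorem appHamiltonian_isFormalAdjoint (μ ν l : ℝ) :
    (appHamiltonian d μ ν l).IsFormalAdjoint (appHamiltonian d μ ν l) := by
  rintro ⟨x, hx⟩ ⟨y, hy⟩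
  rw [lp.inner_eq_tsum, lp.inner_eq_tsum]
  refine tsum_congr fun n => ?_
  simp only [appHamiltonian_apply, RCLike.inner_apply, map_mul, Complex.conj_ofReal]
  ring

theorem idealHamiltonian_isSelfAdjoint {μ : ℝ} (hμ : μ < 0) (ν φ l : ℝ) :
    IsSelfAdjoint (idealHamiltonian d μ ν φ l) :=
  isSelfAdjoint_of_ket_mem _ (idealHamiltonian_isFormalAdjoint μ ν φ l)
    (ket_mem_idealHamiltonian μ ν φ l) fun ψ η h =>
      mem_idealHamiltonian_domain_of_forall hμ (η := η) fun n => by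
        rw [← h n, inner_idealHamiltonian_ket]

theorem appHamiltonian_ket {μ ν l : ℝ} (n : Config d)
    (h : ket n ∈ (appHamiltonian d μ ν l).domain) :
    appHamiltonian d μ ν l ⟨ket n, h⟩ = ((freeEnergy d μ l n
      - 2 * ν * Real.sqrt (volume d l) * Real.sqrt (n 0 + 1) : ℝ) : ℂ) • ket n := by
  ext m
  rw [appHamiltonian_apply]
  by_cases hm : m = n
  · subst hm; simp
  · simp [ket_apply, hm]

theorem appHamiltonian_isSelfAdjoint {μ : ℝ} (hμ : μ < 0) (ν l : ℝ) :
    IsSelfAdjoint (appHamiltonian d μ ν l) :=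
  isSelfAdjoint_of_ket_mem _ (appHamiltonian_isFormalAdjoint μ ν l)
    (ket_mem_appHamiltonian μ ν l) fun ψ η h =>
      mem_appHamiltonian_domain_of_forall hμ (η := η) fun n => by
        rw [← h n, appHamiltonian_ket, inner_smul_left, inner_ket_left, Complex.conj_ofReal]

/-! ### Charlier polynomials -/

/-- Charlier polynomials, in the normalization in which `charlier a m n` is the coefficient of
`x ^ n * y ^ m / (n! * m!)` in `exp (x * y + a * x - a * y)`. -/
def charlier (a : ℝ) : ℕ → ℕ → ℝ
  | 0, n => a ^ n
  | m + 1, n => n * charlier a m (n - 1) - a * charlier a m n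

theorem charlier_zero (a : ℝ) (n : ℕ) : charlier a 0 n = a ^ n := rfl

theorem charlier_succ (a : ℝ) (m n : ℕ) :
    charlier a (m + 1) n = n * charlier a m (n - 1) - a * charlier a m n := rfl

/-- With G = exp(xy + ax - ay), the defining recursion is ∂_y G = (x - a)G and this one is ∂_x G =
(y + a)G. The truncated `m - 1` at m = 0 carries the factor 0. -/
theorem charlier_succ_right (a : ℝ) (m n : ℕ) :
    charlier a m (n + 1) = m * charlier a (m - 1) n + a * charlier a m n := by
  induction m generalizing n with
  | zero => simp [charlier_zero, pow_succ, mul_comm]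
  | succ m ih =>
    rw [charlier_succ, add_tsub_cancel_right, add_tsub_cancel_right, charlier_succ, ih]
    cases n with
    | zero =>
      cases m with
      | zero => simp; ring
      | succ m => simp [charlier_succ]; ring
    | succ n =>
      cases m with
      | zero => simp [charlier_zero]; ring
      | succ m =>
        have h := ih n
        have h' := charlier_succ a m (n + 1)
        simp only [add_tsub_cancel_right] at h h' ⊢
        push_cast at *
        linear_combination (n + 1 : ℝ) * h - (m + 1 : ℝ) * h'

/-- The generating function is invariant under (x, y) ↦ (-y, -x). -/
theorem charlier_symm (a : ℝ) (m n : ℕ) :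
    charlier a m n = (-1) ^ (m + n) * charlier a n m := by
  induction m generalizing n with
  | zero =>
    induction n with
    | zero => simp
    | succ n ih =>
      rw [charlier_succ, charlier_succ_right, ih]
      simp only [CharP.cast_eq_zero, zero_mul, zero_add, zero_sub]
      ring
  | succ m ih =>
    rw [charlier_succ, charlier_succ_right, ih n, ih (n - 1)]
    cases n with
    | zero => simp; ring
    | succ n => simp; ring

/-- Eliminating the neighbouring indices m ± 1 between the two recursions leaves a difference
equation in n alone. It is the eigenvalue equation of a†a - a(a† + a), up to the normalization by
√(n!). -/
theorem charlier_recurrence (a : ℝ) (m n : ℕ) :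
    n * charlier a m n - a * (n * charlier a m (n - 1)) - a * charlier a m (n + 1) =
      (m - a ^ 2) * charlier a m n := by
  rw [charlier_succ_right]
  cases m with
  | zero => cases n with
    | zero => simp [charlier_zero]; ring
    | succ n => simp [charlier_zero, pow_succ]; ring
  | succ m =>
    cases n with
    | zero => simp [charlier_succ]; ring
    | succ n =>
      have h := charlier_succ_right a (m + 1) n
      have h' := charlier_succ a m (n + 1)
      simp only [add_tsub_cancel_right] at h h' ⊢
      push_cast at *
      linear_combination (n + 1 : ℝ) * h - (m + 1 : ℝ) * h'

/-- Any exponential bound in n suffices, since the sums carry the weight 1/n!. -/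
theorem exists_abs_charlier_le (a : ℝ) (m : ℕ) :
    ∃ K R : ℝ, 0 ≤ K ∧ 0 ≤ R ∧ ∀ n, |charlier a m n| ≤ K * R ^ n := by
  induction m with
  | zero => exact ⟨1, |a|, zero_le_one, abs_nonneg a, fun n => by simp [charlier_zero]⟩
  | succ m ih =>
    obtain ⟨K, R, hK, hR, h⟩ := ih
    refine ⟨K + |a| * K, 2 * (R + 1), by positivity, by positivity, fun n => ?_⟩
    have h1 : |(n : ℝ) * charlier a m (n - 1)| ≤ K * (2 * (R + 1)) ^ n := by
      rw [abs_mul, Nat.abs_cast]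
      have hn : (n : ℝ) ≤ 2 ^ n := by exact_mod_cast Nat.lt_two_pow_self.le
      calc (n : ℝ) * |charlier a m (n - 1)| ≤ 2 ^ n * (K * (R + 1) ^ n) := by
            gcongr
            refine (h _).trans ?_
            gcongr
            calc R ^ (n - 1) ≤ (R + 1) ^ (n - 1) := by gcongr; linarith
              _ ≤ (R + 1) ^ n := pow_le_pow_right₀ (by linarith) (Nat.sub_le n 1)
        _ = _ := by rw [mul_pow]; ring
    have h2 : |a * charlier a m n| ≤ |a| * K * (2 * (R + 1)) ^ n := by
      rw [abs_mul, mul_assoc]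
      gcongr
      refine (h n).trans ?_
      gcongr
      linarith
    calc |charlier a (m + 1) n| ≤ _ := abs_sub _ _
      _ ≤ _ := add_le_add h1 h2
      _ = _ := by ring

theorem summable_charlier_mul (a : ℝ) (m m' : ℕ) :
    Summable fun n : ℕ => charlier a m n * charlier a m' n / n.factorial := by
  obtain ⟨K, R, hK, hR, h⟩ := exists_abs_charlier_le a m
  obtain ⟨K', R', hK', hR', h'⟩ := exists_abs_charlier_le a m'
  refine Summable.of_norm_bounded
    ((Real.summable_pow_div_factorial (R * R')).mul_left (K * K')) fun n => ?_
  rw [Real.norm_eq_abs, abs_div, abs_mul, Nat.abs_cast]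
  calc _ ≤ (K * R ^ n) * (K' * R' ^ n) / n.factorial := by
        gcongr
        · exact h n
        · exact h' n
    _ = _ := by rw [mul_pow]; ring

theorem hasSum_charlier_shift {a : ℝ} {m m' : ℕ} {s : ℝ}
    (h : HasSum (fun n : ℕ => charlier a m n * charlier a m' (n + 1) / n.factorial) s) :
    HasSum (fun n : ℕ => n * charlier a m (n - 1) * charlier a m' n / n.factorial) s := by
  rw [← hasSum_nat_add_iff' 1]
  simp only [Finset.sum_range_one, CharP.cast_eq_zero, zero_mul, zero_div, sub_zero]
  convert! h using 2 with n
  rw [Nat.factorial_succ]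
  have : (n.factorial : ℝ) ≠ 0 := by positivity
  push_cast
  have : (n : ℝ) + 1 ≠ 0 := by positivity
  field_simp

/-- For the weight 1/n!, the operator f(n) ↦ n f(n - 1) is adjoint to the forward shift. The former
minus a raises m, the latter minus a lowers m', so the inner product of (m + 1, m') is m' times that
of (m, m' - 1), and induction ends at ∑ a^{2n}/n!. -/
theorem hasSum_charlier_mul (a : ℝ) (m m' : ℕ) :
    HasSum (fun n : ℕ => charlier a m n * charlier a m' n / n.factorial)
      (if m = m' then m.factorial * Real.exp (a ^ 2) else 0) := by
  have key (m m' : ℕ) : ∑' n : ℕ, charlier a (m + 1) n * charlier a m' n / n.factorial =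
      m' * ∑' n : ℕ, charlier a m n * charlier a (m' - 1) n / n.factorial := by
    have h1 := (((summable_charlier_mul a m (m' - 1)).hasSum.mul_left (m' : ℝ)).add
      ((summable_charlier_mul a m m').hasSum.mul_left a))
    have h2 := hasSum_charlier_shift (a := a) (m := m) (m' := m') (by
      convert! h1 using 2 with n
      rw [charlier_succ_right]; ring)
    have h3 := h2.sub ((summable_charlier_mul a m m').hasSum.mul_left a)
    rw [add_sub_cancel_right] at h3
    refine HasSum.tsum_eq ?_
    convert! h3 using 2 with n
    rw [charlier_succ]; ring
  rw [(summable_charlier_mul a m m').hasSum_iff]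
  induction m generalizing m' with
  | zero =>
    cases m' with
    | zero =>
      simp only [charlier_zero, ← pow_two, if_true, Nat.factorial_zero, Nat.cast_one,
        one_mul]
      rw [Real.exp_eq_exp_ℝ, NormedSpace.exp_eq_tsum_div]
      exact tsum_congr fun n => by rw [← pow_mul, ← pow_mul, mul_comm]
    | succ m' =>
      -- With the roles exchanged, lowering the index 0 gives the factor 0.
      have := key m' 0
      simp only [CharP.cast_eq_zero, zero_mul] at this
      simpa only [mul_comm, reduceCtorEq, if_false, right_eq_add, Nat.add_eq_zero_iff, one_ne_zero,
        and_false] using this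
  | succ m ih =>
    rw [key, ih]
    cases m' with
    | zero => simp
    | succ m' =>
      by_cases h : m = m'
      · subst h; simp [Nat.factorial_succ]; ring
      · simp [h]

/-- The factor n turns 1/n! into 1/(n - 1)!, so the sum is the squared norm of the forward shift, m
C_{m-1} + a C_m. Orthogonality kills the cross term, and m²(m - 1)! = m·m!. -/
theorem hasSum_nat_mul_charlier_sq (a : ℝ) (m : ℕ) :
    HasSum (fun n : ℕ => n * (charlier a m n ^ 2 / n.factorial))
      ((m + a ^ 2) * (m.factorial * Real.exp (a ^ 2))) := by
  rw [← hasSum_nat_add_iff' 1]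
  simp only [Finset.sum_range_one, CharP.cast_eq_zero, zero_mul, sub_zero]
  have h1 := ((hasSum_charlier_mul a (m - 1) (m - 1)).mul_left ((m : ℝ) ^ 2)).add
    (((hasSum_charlier_mul a (m - 1) m).mul_left (2 * a * m)).add
    ((hasSum_charlier_mul a m m).mul_left (a ^ 2)))
  convert! h1 using 1
  · funext n
    rw [charlier_succ_right, Nat.factorial_succ]
    have : (n.factorial : ℝ) ≠ 0 := by positivity
    have : (n : ℝ) + 1 ≠ 0 := by positivity
    push_cast
    field_simp
    ring
  · cases m with
    | zero => simp
    | succ m => simp [Nat.factorial_succ]; ring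

/-! ### Displaced number states of a single mode -/

/-- The displaced number state `m`, as a real function of the occupation number `n`. -/
def displaced (a : ℝ) (m n : ℕ) : ℝ :=
  Real.exp (-(a ^ 2) / 2) * charlier a m n / Real.sqrt (m.factorial * n.factorial)

theorem displaced_mul (a : ℝ) (m m' n : ℕ) : displaced a m n * displaced a m' n =
    Real.exp (-(a ^ 2)) / (Real.sqrt m.factorial * Real.sqrt m'.factorial) *
      (charlier a m n * charlier a m' n / n.factorial) := by
  unfold displaced
  rw [Real.sqrt_mul (by positivity), Real.sqrt_mul (by positivity)]
  have h : Real.exp (-(a ^ 2)) = Real.exp (-(a ^ 2) / 2) * Real.exp (-(a ^ 2) / 2) := by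
    rw [← Real.exp_add]; ring_nf
  have h2 : (n.factorial : ℝ) = Real.sqrt n.factorial * Real.sqrt n.factorial :=
    (Real.mul_self_sqrt (by positivity)).symm
  have : Real.sqrt n.factorial ≠ 0 := (Real.sqrt_pos.2 (by positivity)).ne'
  have : Real.sqrt m.factorial ≠ 0 := (Real.sqrt_pos.2 (by positivity)).ne'
  have : Real.sqrt m'.factorial ≠ 0 := (Real.sqrt_pos.2 (by positivity)).ne'
  rw [h]
  conv_rhs => rw [h2]
  field_simp

theorem hasSum_displaced_mul (a : ℝ) (m m' : ℕ) :
    HasSum (fun n : ℕ => displaced a m n * displaced a m' n) (if m = m' then 1 else 0) := by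
  simp only [displaced_mul]
  convert! (hasSum_charlier_mul a m m').mul_left _ using 1
  by_cases h : m = m'
  · subst h
    have : (m.factorial : ℝ) ≠ 0 := by positivity
    simp only [if_true]
    rw [Real.mul_self_sqrt (by positivity), Real.exp_neg]
    field_simp
  · simp [h]

theorem hasSum_nat_mul_displaced_sq (a : ℝ) (m : ℕ) :
    HasSum (fun n : ℕ => n * (displaced a m n * displaced a m n)) (m + a ^ 2) := by
  simp only [displaced_mul]
  convert! (hasSum_nat_mul_charlier_sq a m).mul_left
    (Real.exp (-(a ^ 2)) / (Real.sqrt m.factorial * Real.sqrt m.factorial)) using 1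
  · funext n; ring
  · have : (m.factorial : ℝ) ≠ 0 := by positivity
    rw [Real.mul_self_sqrt (by positivity), Real.exp_neg]
    field_simp

theorem displaced_symm (a : ℝ) (m n : ℕ) :
    displaced a m n = (-1) ^ (m + n) * displaced a n m := by
  unfold displaced
  rw [charlier_symm, mul_comm (m.factorial : ℝ)]
  ring

/-- The symmetry in m and n turns normalization into its dual, the Parseval identity needed for
completeness. -/
theorem hasSum_displaced_sq (a : ℝ) (n : ℕ) :
    HasSum (fun m : ℕ => displaced a m n * displaced a m n) 1 := by
  convert! hasSum_displaced_mul a n n using 1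
  · funext m
    rw [displaced_symm, mul_mul_mul_comm, ← pow_add, Even.neg_one_pow ⟨m + n, rfl⟩, one_mul]
  · simp

theorem displaced_recurrence (a : ℝ) (m n : ℕ) :
    n * displaced a m n - a * (Real.sqrt n * displaced a m (n - 1)
      + Real.sqrt (n + 1) * displaced a m (n + 1)) = (m - a ^ 2) * displaced a m n := by
  have h1 : Real.sqrt n * displaced a m (n - 1) = Real.exp (-(a ^ 2) / 2) *
      (n * charlier a m (n - 1)) / Real.sqrt (m.factorial * n.factorial) := by
    cases n with
    | zero => simp
    | succ n =>
      simp only [displaced, add_tsub_cancel_right, Nat.factorial_succ]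
      push_cast
      rw [mul_left_comm (m.factorial : ℝ) ((n : ℝ) + 1),
        Real.sqrt_mul (show (0 : ℝ) ≤ n + 1 by positivity)]
      have : Real.sqrt (m.factorial * n.factorial : ℝ) ≠ 0 := (Real.sqrt_pos.2 (by positivity)).ne'
      have : Real.sqrt (n + 1 : ℝ) ≠ 0 := (Real.sqrt_pos.2 (by positivity)).ne'
      have h2 : (n + 1 : ℝ) = Real.sqrt (n + 1) * Real.sqrt (n + 1) :=
        (Real.mul_self_sqrt (by positivity)).symm
      generalize Real.sqrt (m.factorial * n.factorial : ℝ) = s at *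
      generalize Real.sqrt (n + 1 : ℝ) = t at *
      rw [h2]
      field_simp
  have h2 : Real.sqrt (n + 1) * displaced a m (n + 1) = Real.exp (-(a ^ 2) / 2) *
      charlier a m (n + 1) / Real.sqrt (m.factorial * n.factorial) := by
    simp only [displaced, Nat.factorial_succ]
    push_cast
    rw [mul_left_comm (m.factorial : ℝ) ((n : ℝ) + 1),
        Real.sqrt_mul (show (0 : ℝ) ≤ n + 1 by positivity)]
    have : Real.sqrt (m.factorial * n.factorial : ℝ) ≠ 0 := (Real.sqrt_pos.2 (by positivity)).ne'
    have : Real.sqrt (n + 1 : ℝ) ≠ 0 := (Real.sqrt_pos.2 (by positivity)).ne'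
    field_simp
  rw [h1, h2, displaced]
  linear_combination Real.exp (-(a ^ 2) / 2) / Real.sqrt (m.factorial * n.factorial) *
    charlier_recurrence a m n

/-! ### The displaced basis of the Fock space and the eigenvectors of the ideal gas -/

/-- The configuration that has `j` particles in the zero mode and agrees with `c` elsewhere. -/
def slice (c : Config d) (j : ℕ) : Config d := c.erase 0 + Finsupp.single 0 j

@[simp] theorem slice_zero_mode (c : Config d) (j : ℕ) : slice c j 0 = j := by simp [slice]

@[simp] theorem erase_slice (c : Config d) (j : ℕ) : (slice c j).erase 0 = c.erase 0 := by
  ext k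
  by_cases hk : k = 0
  · subst hk; simp
  · simp [slice, Finsupp.erase_ne hk]

theorem slice_of_erase_eq {c n : Config d} (h : n.erase 0 = c.erase 0) : slice c (n 0) = n := by
  rw [slice, ← h, Finsupp.erase_add_single]

theorem slice_congr {c c' : Config d} (h : c.erase 0 = c'.erase 0) : slice c = slice c' := by
  funext j; simp [slice, h]

theorem slice_self (n : Config d) : slice n (n 0) = n := slice_of_erase_eq rfl

theorem slice_injective (c : Config d) : Function.Injective (slice c) := fun i j h => by
  simpa using congrArg (fun n : Config d => n 0) h

theorem erase_ne_of_notMem_range_slice {c n : Config d} (h : n ∉ Set.range (slice c)) :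
    n.erase 0 ≠ c.erase 0 := fun h' => h ⟨n 0, slice_of_erase_eq h'⟩

theorem hasSum_slice_iff {E : Type*} [AddCommMonoid E] [TopologicalSpace E] {f : Config d → E}
    {s : E} (c : Config d) (h : ∀ n, n.erase 0 ≠ c.erase 0 → f n = 0) :
    HasSum (fun j => f (slice c j)) s ↔ HasSum f s :=
  (slice_injective c).hasSum_iff fun n hn => h n (erase_ne_of_notMem_range_slice hn)

theorem freeEnergy_slice (μ l : ℝ) (c : Config d) (j : ℕ) :
    freeEnergy d μ l (slice c j) = freeEnergy d μ l (c.erase 0) + (-μ) * j := by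
  rw [freeEnergy, slice, Finsupp.sum_add_index', Finsupp.sum_single_index]
  · simp [freeEnergy, modeEnergy_zero]
  · simp
  · simp
  · intro k m m'; push_cast; ring

theorem freeEnergy_erase_add (μ l : ℝ) (n : Config d) :
    freeEnergy d μ l n = freeEnergy d μ l (n.erase 0) + (-μ) * n 0 := by
  rw [← freeEnergy_slice, slice_self]

/-- The amplitudes of the displaced number states. -/
def displacedAmplitude (a φ : ℝ) (c n : Config d) : ℂ :=
  if n.erase 0 = c.erase 0 then
    Complex.exp (Complex.I * φ) ^ (n 0) * (displaced a (c 0) (n 0) : ℂ) else 0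

theorem norm_exp_I_mul (φ : ℝ) : ‖Complex.exp (Complex.I * φ)‖ = 1 := by
  rw [mul_comm, Complex.norm_exp_ofReal_mul_I]

theorem norm_displacedAmplitude_slice (a φ : ℝ) (c : Config d) (j : ℕ) :
    ‖displacedAmplitude a φ c (slice c j)‖ ^ 2 = displaced a (c 0) j * displaced a (c 0) j := by
  simp [displacedAmplitude, pow_two]

theorem displacedAmplitude_of_ne {a φ : ℝ} {c n : Config d} (h : n.erase 0 ≠ c.erase 0) :
    displacedAmplitude a φ c n = 0 := if_neg h

theorem memℓp_displacedAmplitude (a φ : ℝ) (c : Config d) :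
    Memℓp (displacedAmplitude a φ c) 2 := by
  rw [memℓp_gen_iff (by simp)]
  simp only [ENNReal.toReal_ofNat, Real.rpow_ofNat]
  refine ((hasSum_slice_iff c fun n hn => ?_).1 ?_).summable (a := 1)
  · simp [displacedAmplitude_of_ne hn]
  · simp only [norm_displacedAmplitude_slice]
    simpa using hasSum_displaced_mul a (c 0) (c 0)

/-- The state in which the zero mode is in a displaced number state and the other modes have
definite occupation numbers. -/
def displacedState (a φ : ℝ) (c : Config d) : Fock d :=
  ⟨displacedAmplitude a φ c, memℓp_displacedAmplitude a φ c⟩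

theorem displacedState_apply (a φ : ℝ) (c n : Config d) :
    displacedState a φ c n = displacedAmplitude a φ c n := rfl

theorem hasSum_mul_norm_displacedState_sq {a φ s : ℝ} {c : Config d} {f : ℕ → ℝ}
    (h : HasSum (fun j => f j * (displaced a (c 0) j * displaced a (c 0) j)) s) :
    HasSum (fun n : Config d => f (n 0) * ‖displacedState a φ c n‖ ^ 2) s := by
  refine (hasSum_slice_iff c fun n hn => ?_).1 ?_
  · simp [displacedState_apply, displacedAmplitude_of_ne hn]
  · simpa only [displacedState_apply, norm_displacedAmplitude_slice, slice_zero_mode] using h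

/-- Different occupations outside the zero mode give disjoint supports. For equal ones the phases
cancel, leaving single-mode orthonormality. -/
theorem orthonormal_displacedState (a φ : ℝ) :
    Orthonormal ℂ (displacedState a φ : Config d → Fock d) := by
  classical
  rw [orthonormal_iff_ite]
  intro c c'
  refine (lp.hasSum_inner _ _).unique ?_
  by_cases hcc : c.erase 0 = c'.erase 0
  · refine (hasSum_slice_iff c fun n hn => ?_).1 ?_
    · simp [displacedState_apply, displacedAmplitude_of_ne hn]
    · have h := (Complex.hasSum_ofReal.2 (hasSum_displaced_mul a (c 0) (c' 0)))
      have hz : Complex.exp (Complex.I * φ) *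
          (starRingEnd ℂ) (Complex.exp (Complex.I * φ)) = 1 := by
        rw [Complex.mul_conj, Complex.normSq_eq_norm_sq, norm_exp_I_mul]; simp
      convert! h using 1
      · funext j
        simp only [displacedState_apply, displacedAmplitude, erase_slice, hcc, if_true,
          slice_zero_mode, RCLike.inner_apply, map_mul, map_pow, Complex.conj_ofReal]
        rw [mul_mul_mul_comm, ← mul_pow, hz, one_pow, one_mul]
        push_cast
        ring
      · by_cases h0 : c 0 = c' 0
        · have : c = c' := by rw [← slice_self c, ← slice_self c', h0, slice_congr hcc]
          simp [this]
        · have : c ≠ c' := fun h => h0 (h ▸ rfl)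
          simp [this, h0]
  · have : c ≠ c' := fun h => hcc (h ▸ rfl)
    rw [if_neg this]
    convert! hasSum_zero using 1
    funext n
    by_cases hn : n.erase 0 = c.erase 0
    · rw [displacedState_apply, displacedState_apply,
        displacedAmplitude_of_ne (hn ▸ hcc : n.erase 0 ≠ c'.erase 0)]
      simp
    · rw [displacedState_apply, displacedAmplitude_of_ne hn]
      simp

theorem hasSum_norm_displacedState_apply_sq (a φ : ℝ) (n : Config d) :
    HasSum (fun c : Config d => ‖displacedState a φ c n‖ ^ 2) 1 := by
  refine (hasSum_slice_iff n fun c hc => ?_).1 ?_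
  · simp [displacedState_apply, displacedAmplitude_of_ne hc.symm]
  · convert! hasSum_displaced_sq a (n 0) using 1
    funext j
    simp [displacedState_apply, displacedAmplitude, pow_two]

/-- If ψ is orthogonal to every v_i, then |n⟩ - tψ has the same coefficients as |n⟩, so Bessel's
inequality forces its norm to be at least 1 for every t. Were ψ(n) ≠ 0, some t would make it
shorter. -/
theorem span_orthogonal_eq_bot_of_parseval {ι : Type*} {v : ι → Fock d} (hv : Orthonormal ℂ v)
    (h : ∀ n, HasSum (fun i => ‖v i n‖ ^ 2) 1) : (Submodule.span ℂ (Set.range v))ᗮ = ⊥ := by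
  rw [Submodule.eq_bot_iff]
  intro ψ hψ
  have hψv : ∀ i, inner ℂ (v i) ψ = 0 := fun i =>
    (Submodule.mem_orthogonal _ _).1 hψ _ (Submodule.subset_span ⟨i, rfl⟩)
  ext n
  have key (t : ℂ) : 1 ≤ ‖ket n - t • ψ‖ ^ 2 := by
    have hle := hv.tsum_inner_products_le (ket n - t • ψ)
    have he : (fun i => ‖inner ℂ (v i) (ket n - t • ψ)‖ ^ 2) = fun i => ‖v i n‖ ^ 2 := by
      funext i
      rw [inner_sub_right, inner_smul_right, hψv, mul_zero, sub_zero, inner_ket_right,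
        RCLike.norm_conj]
    rwa [he, (h n).tsum_eq] at hle
  by_contra hne
  have hψ0 : ψ ≠ 0 := fun h0 => hne (by simp [h0])
  have hpos : 0 < ‖ψ‖ ^ 2 := by positivity
  obtain ⟨z, hz⟩ : ∃ z : ℂ, z = ψ n := ⟨_, rfl⟩
  have hz0 : 0 < ‖z‖ ^ 2 := by
    have : 0 < ‖z‖ := norm_pos_iff.2 (by rw [hz]; simpa using hne)
    positivity
  -- This t minimizes the norm: tψ is the projection of |n⟩ onto ψ.
  have h1 := key (starRingEnd ℂ z / (‖ψ‖ ^ 2 : ℝ))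
  have hre : RCLike.re (inner ℂ (ket n) ((starRingEnd ℂ z / (‖ψ‖ ^ 2 : ℝ)) • ψ)) =
      ‖z‖ ^ 2 / ‖ψ‖ ^ 2 := by
    rw [inner_smul_right, inner_ket_left, ← hz, div_mul_eq_mul_div, Complex.conj_mul',
      ← Complex.ofReal_pow, ← Complex.ofReal_div]
    exact Complex.ofReal_re _
  rw [norm_sub_sq (𝕜 := ℂ), norm_ket, hre, norm_smul, norm_div, RCLike.norm_conj,
    Complex.norm_real, Real.norm_of_nonneg hpos.le] at h1
  have h3 : (‖z‖ / ‖ψ‖ ^ 2 * ‖ψ‖) ^ 2 = ‖z‖ ^ 2 / ‖ψ‖ ^ 2 := by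
    field_simp
  have h4 : 0 < ‖z‖ ^ 2 / ‖ψ‖ ^ 2 := by positivity
  rw [h3] at h1
  linarith

/-- The displaced states form an orthonormal basis of the Fock space. -/
def displacedBasis (d : ℕ) (a φ : ℝ) : HilbertBasis (Config d) ℂ (Fock d) :=
  HilbertBasis.mkOfOrthogonalEqBot (orthonormal_displacedState a φ)
    (span_orthogonal_eq_bot_of_parseval (orthonormal_displacedState a φ)
      (hasSum_norm_displacedState_apply_sq a φ))

theorem displacedBasis_apply (a φ : ℝ) (c : Config d) :
    displacedBasis d a φ c = displacedState a φ c :=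
  congrFun (HilbertBasis.coe_mkOfOrthogonalEqBot _ _) c

/-- The occupation-number states form an orthonormal basis of the Fock space. -/
def ketBasis (d : ℕ) : HilbertBasis (Config d) ℂ (Fock d) :=
  HilbertBasis.ofRepr (LinearIsometryEquiv.refl ℂ (Fock d))

theorem ketBasis_apply (n : Config d) : ketBasis d n = ket n := by
  classical
  rw [← HilbertBasis.repr_symm_single]
  rw [ket]
  change (lp.single 2 n (1 : ℂ) : Fock d) = _
  congr

/-- The factor e^{iφn_0} gauges φ away and the nonzero modes only add a constant, so this is
`displaced_recurrence` multiplied by -μ. The displacement κ/(-μ) is the one that completes the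
square. -/
theorem displacedAmplitude_eigen {μ κ : ℝ} (hμ : μ < 0) (φ l : ℝ) (c n : Config d) :
    (freeEnergy d μ l n : ℂ) * displacedAmplitude (κ / (-μ)) φ c n - (κ : ℂ) *
      (Complex.exp (Complex.I * φ) * ((Real.sqrt (n 0) : ℂ) *
          displacedAmplitude (κ / (-μ)) φ c (n - Finsupp.single 0 1))
        + Complex.exp (-(Complex.I * φ)) * ((Real.sqrt (n 0 + 1) : ℂ) *
          displacedAmplitude (κ / (-μ)) φ c (n + Finsupp.single 0 1))) =
      ((freeEnergy d μ l c - κ ^ 2 / (-μ) : ℝ) : ℂ) * displacedAmplitude (κ / (-μ)) φ c n := by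
  have he1 : (n - Finsupp.single 0 1).erase 0 = n.erase 0 := by
    ext k
    by_cases hk : k = 0
    · subst hk; simp
    · simp [Finsupp.erase_ne hk, hk]
  have he2 : (n + Finsupp.single 0 1).erase 0 = n.erase 0 := by
    ext k
    by_cases hk : k = 0
    · subst hk; simp
    · simp [Finsupp.erase_ne hk]
  by_cases hn : n.erase 0 = c.erase 0
  · simp only [displacedAmplitude, he1, he2, hn, if_true]
    rw [freeEnergy_erase_add μ l n, freeEnergy_erase_add μ l c, hn]
    simp only [Finsupp.tsub_apply, Finsupp.add_apply, Finsupp.single_eq_same]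
    set a := κ / (-μ) with ha
    have hκ : κ = a * (-μ) := by rw [ha]; field_simp [hμ.ne]
    have hrec := displaced_recurrence a (c 0) (n 0)
    have hsq : κ ^ 2 / (-μ) = a ^ 2 * (-μ) := by rw [ha]; field_simp [hμ.ne]
    rw [hsq, hκ]
    set z := Complex.exp (Complex.I * φ) with hz
    have hzi : Complex.exp (-(Complex.I * φ)) * z = 1 := by rw [hz, ← Complex.exp_add]; simp
    have e1 : z * ((Real.sqrt (n 0) : ℂ) * (z ^ (n 0 - 1) * (displaced a (c 0) (n 0 - 1) : ℂ))) =
        z ^ (n 0) * ((Real.sqrt (n 0) : ℂ) * (displaced a (c 0) (n 0 - 1) : ℂ)) := by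
      cases n 0 with
      | zero => simp
      | succ j => rw [add_tsub_cancel_right, pow_succ]; ring
    have e2 : Complex.exp (-(Complex.I * φ)) * ((Real.sqrt (n 0 + 1) : ℂ) *
          (z ^ (n 0 + 1) * (displaced a (c 0) (n 0 + 1) : ℂ))) =
        z ^ (n 0) * ((Real.sqrt (n 0 + 1) : ℂ) * (displaced a (c 0) (n 0 + 1) : ℂ)) := by
      rw [pow_succ]
      linear_combination (z ^ (n 0) * ((Real.sqrt (n 0 + 1) : ℂ) *
        (displaced a (c 0) (n 0 + 1) : ℂ))) * hzi
    rw [e1, e2]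
    have hrec' := congrArg (fun x : ℝ => (x : ℂ)) hrec
    push_cast at hrec' ⊢
    linear_combination (-(μ : ℂ)) * z ^ (n 0) * hrec'
  · simp [displacedAmplitude, he1, he2, hn]

theorem displacedState_eigen {μ : ℝ} (hμ : μ < 0) (ν φ l : ℝ) (c : Config d) :
    ∃ h : displacedState (ν * Real.sqrt (volume d l) / (-μ)) φ c ∈
        (idealHamiltonian d μ ν φ l).domain,
      idealHamiltonian d μ ν φ l ⟨_, h⟩ =
        ((freeEnergy d μ l c - (ν * Real.sqrt (volume d l)) ^ 2 / (-μ) : ℝ) : ℂ) •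
          displacedState (ν * Real.sqrt (volume d l) / (-μ)) φ c := by
  have h := displacedAmplitude_eigen (κ := ν * Real.sqrt (volume d l)) hμ φ l c
  refine ⟨mem_idealHamiltonian_domain_of_forall hμ (η :=
    ((freeEnergy d μ l c - (ν * Real.sqrt (volume d l)) ^ 2 / (-μ) : ℝ) : ℂ) •
      displacedState (ν * Real.sqrt (volume d l) / (-μ)) φ c) fun n => h n, ?_⟩
  ext n
  rw [idealHamiltonian_apply]
  exact h n

/-! ### Boltzmann operators and traces in an eigenbasis -/

theorem exists_clm_apply_basis {ι E : Type*} [NormedAddCommGroup E] [InnerProductSpace ℂ E]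
    (b : HilbertBasis ι ℂ E) (w : ι → ℂ) (C : ℝ) (hw : ∀ i, ‖w i‖ ≤ C) :
    ∃ T : E →L[ℂ] E, ∀ i, T (b i) = w i • b i := by
  classical
  have hmem (f : lp (fun _ : ι => ℂ) 2) : Memℓp (fun i => w i * f i) 2 := by
    refine memℓp_two_of_norm_le ((lp.memℓp f).const_smul (C : ℂ)) fun i => ?_
    simp only [norm_mul, Pi.smul_apply, smul_eq_mul, Complex.norm_real, Real.norm_eq_abs]
    exact mul_le_mul_of_nonneg_right ((hw i).trans (le_abs_self C)) (norm_nonneg _)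
  let M : lp (fun _ : ι => ℂ) 2 →ₗ[ℂ] lp (fun _ : ι => ℂ) 2 :=
    { toFun := fun f => ⟨fun i => w i * f i, hmem f⟩
      map_add' := fun f g => by ext i; exact mul_add _ _ _
      map_smul' := fun z f => by ext i; exact mul_left_comm _ _ _ }
  have hM (f : lp (fun _ : ι => ℂ) 2) (i : ι) : M f i = w i * f i := rfl
  let M' := M.mkContinuous |C| fun f => by
    have h : ‖M f‖ ≤ ‖(C : ℂ) • f‖ := lp.norm_mono (by simp) fun i => by
      rw [hM, lp.coeFn_smul, Pi.smul_apply, smul_eq_mul, norm_mul, norm_mul, Complex.norm_real]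
      exact mul_le_mul_of_nonneg_right ((hw i).trans (le_abs_self C)) (norm_nonneg _)
    rwa [norm_smul, Complex.norm_real, Real.norm_eq_abs] at h
  refine ⟨(b.repr.symm.toContinuousLinearEquiv : _ →L[ℂ] E) ∘L M' ∘L
    (b.repr.toContinuousLinearEquiv : E →L[ℂ] _), fun i => ?_⟩
  have h1 : M (lp.single 2 i (1 : ℂ)) = w i • lp.single 2 i (1 : ℂ) := by
    ext j
    rw [hM, lp.coeFn_smul, Pi.smul_apply, smul_eq_mul]
    by_cases hj : j = i
    · subst hj; rfl
    · simp [hj]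
  change b.repr.symm (M (b.repr (b i))) = _
  rw [b.repr_self, h1, map_smul, b.repr_symm_single]

/-- By symmetry of H, vectors of the two eigenbases overlap only when their eigenvalues agree.
Expanding one basis in the other, T' therefore acts on it with the same factors as T. -/
theorem IsBoltzmannOperator.unique {H : Fock d →ₗ.[ℂ] Fock d} {β : ℝ} {T T' : Fock d →L[ℂ] Fock d}
    (hT : IsBoltzmannOperator H β T) (hT' : IsBoltzmannOperator H β T') : T = T' := by
  obtain ⟨hH, ι, b, E, hb⟩ := hT
  obtain ⟨-, ι', b', E', hb'⟩ := hT'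
  have hsymm : H.IsFormalAdjoint H := by
    have := LinearPMap.adjoint_isFormalAdjoint hH.dense_domain
    rwa [LinearPMap.isSelfAdjoint_def.1 hH] at this
  have key (i : ι) (j : ι') : inner ℂ (b' j) (b i) * ((Real.exp (-β * E' j) : ℂ)) =
      inner ℂ (b' j) (b i) * ((Real.exp (-β * E i) : ℂ)) := by
    obtain ⟨⟨h, hH⟩, -⟩ := hb i
    obtain ⟨⟨h', hH'⟩, -⟩ := hb' j
    have := hsymm ⟨_, h'⟩ ⟨_, h⟩
    rw [hH, hH', inner_smul_left, inner_smul_right, Complex.conj_ofReal] at this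
    by_cases hE : E' j = E i
    · rw [hE]
    · have h0 : inner ℂ (b' j) (b i) = 0 := by
        have h1 : ((E' j : ℂ) - E i) * inner ℂ (b' j) (b i) = 0 := by
          linear_combination this
        refine (mul_eq_zero.1 h1).resolve_left fun h2 => hE ?_
        exact_mod_cast sub_eq_zero.1 h2
      rw [h0, zero_mul, zero_mul]
  refine ContinuousLinearMap.ext_on (s := Set.range b) ?_ ?_
  · have := b.dense_span
    rw [dense_iff_closure_eq, ← Submodule.topologicalClosure_coe, this, Submodule.top_coe]
  · rintro _ ⟨i, rfl⟩
    have h1 := (b'.hasSum_repr (b i)).mapL T'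
    have h2 := (b'.hasSum_repr (b i)).const_smul (Real.exp (-β * E i) : ℂ)
    rw [(hb i).2]
    refine h2.unique ?_
    convert! h1 using 1
    funext j
    rw [map_smul, (hb' j).2, smul_smul, smul_smul, b'.repr_apply_apply, key, mul_comm]

theorem boltzmann_eq {H : Fock d →ₗ.[ℂ] Fock d} {β : ℝ} {T : Fock d →L[ℂ] Fock d}
    (hT : IsBoltzmannOperator H β T) : boltzmann H β = T := by
  have h : ∃ T, IsBoltzmannOperator H β T := ⟨T, hT⟩
  rw [boltzmann, dif_pos h]
  exact h.choose_spec.unique hT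

/-- An orthonormal basis of eigenvectors of `H`, with eigenvalues bounded from below. -/
structure Diagonalizes {ι : Type} (H : Fock d →ₗ.[ℂ] Fock d) (b : HilbertBasis ι ℂ (Fock d))
    (E : ι → ℝ) : Prop where
  isSelfAdjoint : IsSelfAdjoint H
  eigen : ∀ i, ∃ h : b i ∈ H.domain, H ⟨b i, h⟩ = (E i : ℂ) • b i
  bddBelow : ∃ M, ∀ i, M ≤ E i

namespace Diagonalizes

variable {ι : Type} {H : Fock d →ₗ.[ℂ] Fock d} {b : HilbertBasis ι ℂ (Fock d)} {E : ι → ℝ}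

theorem exists_boltzmann (h : Diagonalizes H b E) {β : ℝ} (hβ : 0 < β) :
    ∃ T, IsBoltzmannOperator H β T ∧ ∀ i, T (b i) = (Real.exp (-β * E i) : ℂ) • b i := by
  obtain ⟨M, hM⟩ := h.bddBelow
  obtain ⟨T, hT⟩ := exists_clm_apply_basis b (fun i => (Real.exp (-β * E i) : ℂ))
    (Real.exp (-β * M)) fun i => by
      rw [Complex.norm_real, Real.norm_of_nonneg (Real.exp_pos _).le]
      exact Real.exp_le_exp.2 (by nlinarith [hM i])
  exact ⟨T, ⟨h.isSelfAdjoint, ι, b, E, fun i => ⟨h.eigen i, hT i⟩⟩, hT⟩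

theorem hasSum_weight (h : Diagonalizes H b E) {β : ℝ} (hβ : 0 < β) (n : Config d) :
    HasSum (fun i => Real.exp (-β * E i) * ‖b i n‖ ^ 2) (weight H β n) := by
  obtain ⟨T, hT, hTb⟩ := h.exists_boltzmann hβ
  have h1 := ((b.hasSum_repr (ket n)).mapL T).mapL (innerSL ℂ (ket n : Fock d))
  have h2 := Complex.hasSum_re h1
  rw [weight, boltzmann_eq hT]
  convert! h2 using 1
  funext i
  rw [map_smul, hTb, map_smul, map_smul, innerSL_apply_apply, inner_ket_left, b.repr_apply_apply,
    inner_ket_right, smul_eq_mul, smul_eq_mul, mul_left_comm, Complex.conj_mul',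
    ← Complex.ofReal_pow, ← Complex.ofReal_mul, Complex.ofReal_re]

/-- Tonelli: the double sum over eigenvectors and configurations has nonnegative terms, so the trace
taken in the occupation basis may be computed in the eigenbasis, where `M i` is the mean of f in the
i-th eigenvector. -/
theorem hasSum_mul_weight (h : Diagonalizes H b E) {β : ℝ} (hβ : 0 < β) {f : Config d → ℝ}
    (hf : ∀ n, 0 ≤ f n) {M : ι → ℝ} (hM : ∀ i, HasSum (fun n => f n * ‖b i n‖ ^ 2) (M i)) {S : ℝ}
    (hS : HasSum (fun i => Real.exp (-β * E i) * M i) S) :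
    HasSum (fun n => f n * weight H β n) S := by
  let F : ι × Config d → ℝ := fun p => Real.exp (-β * E p.1) * (f p.2 * ‖b p.1 p.2‖ ^ 2)
  have hrow (i : ι) : HasSum (fun n => F (i, n)) (Real.exp (-β * E i) * M i) :=
    (hM i).mul_left _
  have hF : Summable F := by
    refine (summable_prod_of_nonneg fun p => ?_).2 ⟨fun i => (hrow i).summable, ?_⟩
    · exact mul_nonneg (Real.exp_pos _).le (mul_nonneg (hf _) (by positivity))
    · simpa only [(hrow _).tsum_eq] using hS.summable
  have hFS : HasSum F S := by
    have := hF.hasSum.prod_fiberwise hrow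
    rw [hS.unique this]
    exact hF.hasSum
  refine ((Equiv.prodComm _ _).hasSum_iff.2 hFS).prod_fiberwise fun n => ?_
  convert! (h.hasSum_weight hβ n).mul_left (f n) using 1
  funext i
  simp only [F, Function.comp, Equiv.prodComm_apply, Prod.swap]
  ring

end Diagonalizes

/-! ### Diagonalization of the two models -/

theorem appHamiltonian_diagonalizes {μ : ℝ} (hμ : μ < 0) (ν l : ℝ) :
    Diagonalizes (appHamiltonian d μ ν l) (ketBasis d) fun n => freeEnergy d μ l n
      - 2 * ν * Real.sqrt (volume d l) * Real.sqrt (n 0 + 1) where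
  isSelfAdjoint := appHamiltonian_isSelfAdjoint hμ ν l
  eigen n := by
    rw [ketBasis_apply]
    exact ⟨ket_mem_appHamiltonian μ ν l n, appHamiltonian_ket n _⟩
  bddBelow := by
    set c := ν * Real.sqrt (volume d l) with hc
    -- Completing the square in √(n_0 + 1) costs c²/(-μ); the extra μ comes from replacing n_0 by
    -- n_0 + 1.
    refine ⟨μ - c ^ 2 / (-μ), fun n => ?_⟩
    have hz := zeroMode_le_freeEnergy hμ l n
    have hs : Real.sqrt (n 0 + 1) ^ 2 = n 0 + 1 := Real.sq_sqrt (by positivity)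
    have h1 : 0 ≤ (c - (-μ) * Real.sqrt (n 0 + 1)) ^ 2 / (-μ) :=
      div_nonneg (sq_nonneg _) (by linarith)
    have hne : μ ≠ 0 := hμ.ne
    have h2 : (c - (-μ) * Real.sqrt (n 0 + 1)) ^ 2 / (-μ) =
        c ^ 2 / (-μ) - 2 * c * Real.sqrt (n 0 + 1) + (-μ) * Real.sqrt (n 0 + 1) ^ 2 := by
      field_simp
      ring
    rw [h2, hs] at h1
    rw [mul_assoc 2 ν, ← hc]
    linarith

theorem idealHamiltonian_diagonalizes {μ : ℝ} (hμ : μ < 0) (ν φ l : ℝ) :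
    Diagonalizes (idealHamiltonian d μ ν φ l)
      (displacedBasis d (ν * Real.sqrt (volume d l) / (-μ)) φ) fun n =>
        freeEnergy d μ l n - (ν * Real.sqrt (volume d l)) ^ 2 / (-μ) where
  isSelfAdjoint := idealHamiltonian_isSelfAdjoint hμ ν φ l
  eigen c := by
    rw [displacedBasis_apply]
    exact displacedState_eigen hμ ν φ l c
  bddBelow := ⟨- ((ν * Real.sqrt (volume d l)) ^ 2 / (-μ)), fun n => by
    linarith [freeEnergy_nonneg hμ l n]⟩

/-! ### Sums over configurations as products over modes -/

section FreeSums

variable {κ : Type*}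

/-- Splitting off the value at `k` from finitely supported functions. -/
def eraseEquiv (k : κ) (A : Set (κ →₀ ℕ)) (hA : ∀ m ∈ A, m k = 0) :
    A × ℕ ≃ {n : κ →₀ ℕ | n.erase k ∈ A} where
  toFun p := ⟨p.1 + Finsupp.single k p.2, by
    have h : Finsupp.erase k (p.1 : κ →₀ ℕ) = p.1 :=
      Finsupp.erase_of_notMem_support (Finsupp.notMem_support_iff.2 (hA _ p.1.2))
    simp [Finsupp.erase_add, h]⟩
  invFun n := (⟨(n : κ →₀ ℕ).erase k, n.2⟩, (n : κ →₀ ℕ) k)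
  left_inv p := by
    have h : Finsupp.erase k (p.1 : κ →₀ ℕ) = p.1 :=
      Finsupp.erase_of_notMem_support (Finsupp.notMem_support_iff.2 (hA _ p.1.2))
    have h0 := hA _ p.1.2
    ext <;> simp [Finsupp.erase_add, h0]
  right_inv n := by
    ext1
    exact Finsupp.erase_add_single k (n : κ →₀ ℕ)

theorem hasSum_erase_mul {k : κ} {A : Set (κ →₀ ℕ)} (hA : ∀ m ∈ A, m k = 0)
    {u : (κ →₀ ℕ) → ℝ} {h : ℕ → ℝ} (hu : ∀ n, 0 ≤ u n) (hh : ∀ j, 0 ≤ h j) {s t : ℝ}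
    (hs : HasSum (fun m : A => u m) s) (ht : HasSum h t) :
    HasSum (fun n : {n : κ →₀ ℕ | n.erase k ∈ A} => u ((n : κ →₀ ℕ).erase k) * h (n.1 k))
      (s * t) := by
  exact (eraseEquiv k A hA).symm.hasSum_iff.2 (hs.mul ht
    (hs.summable.mul_of_nonneg ht.summable (fun m => hu m) hh))

theorem prod_pow_nonneg {x : κ → ℝ} (hx : ∀ k, 0 ≤ x k) (n : κ →₀ ℕ) :
    0 ≤ n.prod fun k m => x k ^ m :=
  Finset.prod_nonneg fun k _ => pow_nonneg (hx k) _

theorem prod_pow_eq_erase_mul (x : κ → ℝ) (k : κ) (n : κ →₀ ℕ) :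
    (n.prod fun k m => x k ^ m) = ((n.erase k).prod fun k m => x k ^ m) * x k ^ n k := by
  rw [← Finsupp.mul_prod_erase' n k _ fun _ => pow_zero _, mul_comm]

theorem hasSum_prod_pow_of_support_subset {x : κ → ℝ} (hx : ∀ k, 0 ≤ x k) (hx1 : ∀ k, x k < 1)
    (S : Finset κ) :
    HasSum (fun n : {n : κ →₀ ℕ | n.support ⊆ S} => (n : κ →₀ ℕ).prod fun k m => x k ^ m)
      (∏ k ∈ S, (1 - x k)⁻¹) := by
  classical
  induction S using Finset.induction_on with
  | empty =>
    have hz : (0 : κ →₀ ℕ) ∈ {n : κ →₀ ℕ | n.support ⊆ (∅ : Finset κ)} := by simp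
    have := hasSum_single (f := fun n : {n : κ →₀ ℕ | n.support ⊆ (∅ : Finset κ)} =>
      (n : κ →₀ ℕ).prod fun k m => x k ^ m) ⟨0, hz⟩ fun n hn => by
        refine absurd (Subtype.ext ?_) hn
        simpa using n.2
    simpa using this
  | insert k S hk ih =>
    have hset : {n : κ →₀ ℕ | n.support ⊆ insert k S} =
        {n : κ →₀ ℕ | n.erase k ∈ {n : κ →₀ ℕ | n.support ⊆ S}} := by
      ext n
      simp only [Set.mem_ofPred_eq, Finsupp.support_erase, Finset.subset_insert_iff]
    have h := hasSum_erase_mul (k := k) (A := {n : κ →₀ ℕ | n.support ⊆ S})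
      (fun m hm => Finsupp.notMem_support_iff.1 fun h => hk (hm h))
      (prod_pow_nonneg hx) (fun j => pow_nonneg (hx k) j) ih
      (hasSum_geometric_of_lt_one (hx k) (hx1 k))
    rw [hset, Finset.prod_insert hk, mul_comm]
    simpa only [← prod_pow_eq_erase_mul] using h

/-- All terms are nonnegative and any finite set of configurations occupies finitely many modes, so
the sum is the supremum of the finite products of geometric series. Logarithms replace the infinite
product by a sum. -/
theorem hasSum_prod_pow {x : κ → ℝ} (hx : ∀ k, 0 ≤ x k) (hx1 : ∀ k, x k < 1) {L : ℝ}
    (hL : HasSum (fun k => -Real.log (1 - x k)) L) :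
    HasSum (fun n : κ →₀ ℕ => n.prod fun k m => x k ^ m) (Real.exp L) := by
  classical
  have hexp (S : Finset κ) : ∏ k ∈ S, (1 - x k)⁻¹ = Real.exp (∑ k ∈ S, -Real.log (1 - x k)) := by
    rw [Real.exp_sum]
    refine Finset.prod_congr rfl fun k _ => ?_
    rw [Real.exp_neg, Real.exp_log (by linarith [hx1 k])]
  have hlog (k : κ) : 0 ≤ -Real.log (1 - x k) := by
    rw [neg_nonneg]
    exact Real.log_nonpos (by linarith [hx1 k]) (by linarith [hx k])
  refine hasSum_of_isLUB_of_nonneg _ (prod_pow_nonneg hx) ⟨?_, fun B hB => ?_⟩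
  · rintro _ ⟨F, rfl⟩
    let S := F.biUnion Finsupp.support
    have hF : ∀ n ∈ F, n ∈ {n : κ →₀ ℕ | n.support ⊆ S} := fun n hn =>
      Finset.subset_biUnion_of_mem Finsupp.support hn
    have h1 := hasSum_prod_pow_of_support_subset hx hx1 S
    have h2 := sum_le_hasSum (F.subtype (· ∈ {n : κ →₀ ℕ | n.support ⊆ S}))
      (fun n _ => prod_pow_nonneg hx (n : κ →₀ ℕ)) h1
    rw [hexp, Finset.sum_subtype_of_mem (fun n : κ →₀ ℕ => n.prod fun k m => x k ^ m) hF] at h2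
    exact h2.trans (Real.exp_le_exp.2 (sum_le_hasSum S (fun k _ => hlog k) hL))
  · have h1 : Tendsto (fun S : Finset κ => Real.exp (∑ k ∈ S, -Real.log (1 - x k))) atTop
        (𝓝 (Real.exp L)) := (Real.continuous_exp.tendsto L).comp hL
    refine le_of_tendsto h1 (Eventually.of_forall fun S => ?_)
    rw [← hexp]
    refine hasSum_le_of_sum_le (hasSum_prod_pow_of_support_subset hx hx1 S) fun F => ?_
    have := hB ⟨F.map (Function.Embedding.subtype _), rfl⟩
    beta_reduce at this
    rw [Finset.sum_map] at this
    exact this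

/-- R is the partition function of the modes other than k. It does not depend on h, so it cancels in
averages and in comparisons with the free gas. -/
theorem exists_hasSum_zeroMode {x : κ → ℝ} (hx : ∀ k, 0 ≤ x k) {k : κ} {X : ℝ}
    (hX : HasSum (fun n : κ →₀ ℕ => n.prod fun k m => x k ^ m) X) :
    ∃ R : ℝ, 0 < R ∧ ∀ (h : ℕ → ℝ) (t : ℝ), (∀ j, 0 ≤ h j) →
      HasSum (fun j => h j * x k ^ j) t →
        HasSum (fun n : κ →₀ ℕ => h (n k) * n.prod fun k m => x k ^ m) (R * t) := by
  let A : Set (κ →₀ ℕ) := {m | m k = 0}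
  have hs : Summable fun m : A => (m : κ →₀ ℕ).prod fun k m => x k ^ m :=
    hX.summable.subtype A
  refine ⟨∑' m : A, (m : κ →₀ ℕ).prod fun k m => x k ^ m, ?_, fun h t hh ht => ?_⟩
  · refine hs.tsum_pos (fun m => prod_pow_nonneg hx (m : κ →₀ ℕ)) ⟨0, rfl⟩ ?_
    simp
  · have h1 := hasSum_erase_mul (k := k) (A := A) (fun m hm => hm) (prod_pow_nonneg hx)
      (fun j => mul_nonneg (hh j) (pow_nonneg (hx k) j)) hs.hasSum ht
    have h2 : {n : κ →₀ ℕ | n.erase k ∈ A} = Set.univ := by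
      ext n; simp [A]
    rw [h2] at h1
    have h3 := (Equiv.Set.univ (κ →₀ ℕ)).symm.hasSum_iff.2 h1
    convert! h3 using 1
    funext n
    simp only [Function.comp, Equiv.Set.univ_symm_apply]
    rw [prod_pow_eq_erase_mul x k n]
    ring

theorem hasSum_pi_prod {α : Type*} {g : α → ℝ} (hg : ∀ a, 0 ≤ g a) {s : ℝ} (hs : HasSum g s)
    (d : ℕ) : HasSum (fun k : Fin d → α => ∏ i, g (k i)) (s ^ d) := by
  induction d with
  | zero =>
    simp
  | succ d ih =>
    have hn : 0 ≤ fun k : Fin d → α => ∏ i, g (k i) := fun k =>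
      Finset.prod_nonneg fun i _ => hg (k i)
    have hgn : 0 ≤ g := hg
    have hsum := Summable.mul_of_nonneg hs.summable ih.summable hgn hn
    have h := HasSum.mul hs ih hsum
    let e : (Fin (d + 1) → α) ≃ α × (Fin d → α) :=
      { toFun := fun k => (k 0, fun i => k i.succ)
        invFun := fun p => Fin.cons p.1 p.2
        left_inv := fun k => Fin.cons_self_tail k
        right_inv := fun p => by simp }
    have h' : HasSum ((fun p : α × (Fin d → α) => g p.1 * ∏ i, g (p.2 i)) ∘ e) (s * s ^ d) :=
      e.hasSum_iff.2 h
    rw [pow_succ']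
    convert! h' using 1
    funext k
    exact Fin.prod_univ_succ _

end FreeSums

/-! ### Theta function and the free pressure -/

theorem summable_exp_neg_mul_int_sq {t : ℝ} (ht : 0 < t) :
    Summable fun j : ℤ => Real.exp (-t * (j : ℝ) ^ 2) := by
  have h : Summable fun n : ℕ => Real.exp (-t * (n : ℝ) ^ 2) := by
    refine Summable.of_nonneg_of_le (fun n => (Real.exp_pos _).le) (fun n => ?_)
      (summable_geometric_of_lt_one (Real.exp_pos (-t)).le (Real.exp_lt_one_iff.2 (by linarith)))
    rw [← Real.exp_nat_mul]
    refine Real.exp_le_exp.2 ?_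
    have : (n : ℝ) ≤ (n : ℝ) ^ 2 := by exact_mod_cast Nat.le_self_pow two_ne_zero n
    nlinarith
  exact Summable.of_nat_of_neg (by simpa using h) (by simpa using h)

/-- The theta function `∑_j exp (-t j²)`. -/
def gaussSum (t : ℝ) : ℝ := ∑' j : ℤ, Real.exp (-t * (j : ℝ) ^ 2)

theorem gaussSum_nonneg (t : ℝ) : 0 ≤ gaussSum t := tsum_nonneg fun _ => (Real.exp_pos _).le

theorem gaussSum_anti {s t : ℝ} (hs : 0 < s) (hst : s ≤ t) : gaussSum t ≤ gaussSum s := by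
  refine (summable_exp_neg_mul_int_sq (hs.trans_le hst)).tsum_le_tsum (fun j => ?_)
    (summable_exp_neg_mul_int_sq hs)
  refine Real.exp_le_exp.2 ?_
  nlinarith [sq_nonneg (j : ℝ)]

theorem gaussSum_poisson {t : ℝ} (ht : 0 < t) :
    gaussSum t = Real.sqrt (Real.pi / t) * gaussSum (Real.pi ^ 2 / t) := by
  have h := Real.tsum_exp_neg_mul_int_sq (a := t / Real.pi) (by positivity)
  have hpi := Real.pi_pos.ne'
  have e1 : -Real.pi * (t / Real.pi) = -t := by field_simp
  have e2 : -Real.pi / (t / Real.pi) = -(Real.pi ^ 2 / t) := by field_simp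
  rw [e1, e2, ← Real.sqrt_eq_rpow, one_div, ← Real.sqrt_inv, inv_div] at h
  exact h

theorem tendsto_gaussSum_atTop : Tendsto gaussSum atTop (𝓝 1) := by
  have h : Tendsto gaussSum atTop (𝓝 (∑' j : ℤ, if j = 0 then (1 : ℝ) else 0)) := by
    refine tendsto_tsum_of_dominated_convergence (bound := fun j : ℤ => Real.exp (-1 * (j : ℝ) ^ 2))
      (summable_exp_neg_mul_int_sq one_pos) (fun j => ?_) ?_
    · by_cases hj : j = 0
      · simp [hj]
      · simp only [hj, if_false]
        refine Real.tendsto_exp_atBot.comp ?_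
        have : (0 : ℝ) < (j : ℝ) ^ 2 := by positivity
        simp only [neg_mul]
        exact tendsto_neg_atTop_atBot.comp (tendsto_id.atTop_mul_const this)
    · filter_upwards [eventually_ge_atTop 1] with t ht j
      rw [Real.norm_of_nonneg (Real.exp_pos _).le]
      refine Real.exp_le_exp.2 ?_
      nlinarith [sq_nonneg (j : ℝ)]
  simpa using h

/-- Poisson summation exchanges the small parameter c/l² for the large one π²l²/c, where only the
term j = 0 survives; the prefactor is √(π/c) l. -/
theorem tendsto_gaussSum_div {c : ℝ} (hc : 0 < c) :
    Tendsto (fun l : ℝ => gaussSum (c / l ^ 2) / l) atTop (𝓝 (Real.sqrt (Real.pi / c))) := by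
  have h : Tendsto (fun l : ℝ => Real.pi ^ 2 / (c / l ^ 2)) atTop atTop := by
    have : (fun l : ℝ => Real.pi ^ 2 / (c / l ^ 2)) = fun l => Real.pi ^ 2 / c * l ^ 2 := by
      funext l; field_simp
    rw [this]
    exact (tendsto_pow_atTop two_ne_zero).const_mul_atTop (by positivity)
  have h1 := (tendsto_gaussSum_atTop.comp h).const_mul (Real.sqrt (Real.pi / c))
  rw [mul_one] at h1
  refine h1.congr' ?_
  filter_upwards [eventually_gt_atTop 0] with l hl
  rw [Function.comp, gaussSum_poisson (t := c / l ^ 2) (by positivity)]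
  have : Real.sqrt (Real.pi / (c / l ^ 2)) = Real.sqrt (Real.pi / c) * l := by
    rw [← Real.sqrt_sq hl.le, ← Real.sqrt_mul (by positivity), Real.sqrt_sq hl.le]
    congr 1
    field_simp
  rw [this]
  field_simp

theorem hasSum_exp_modeEnergy {s l : ℝ} (hs : 0 < s) (hl : 0 < l) (d : ℕ) :
    HasSum (fun k : Mode d => Real.exp (-s * modeEnergy l k))
      (gaussSum (2 * Real.pi ^ 2 * s / l ^ 2) ^ d) := by
  have h := hasSum_pi_prod (fun j : ℤ => (Real.exp_pos _).le)
    (summable_exp_neg_mul_int_sq (t := 2 * Real.pi ^ 2 * s / l ^ 2) (by positivity)).hasSum d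
  convert! h using 1
  funext k
  rw [← Real.exp_sum, modeEnergy, Finset.sum_div, Finset.mul_sum]
  congr 1
  refine Finset.sum_congr rfl fun i _ => ?_
  field_simp

/-- The logarithm of the partition function of the free Bose gas, as a sum over the number of
particles in a permutation cycle. -/
def freeLogPartition (d : ℕ) (β μ l : ℝ) : ℝ :=
  ∑' m : ℕ, Real.exp (β * μ * (m + 1)) / (m + 1) *
    gaussSum (2 * Real.pi ^ 2 * (β * (m + 1)) / l ^ 2) ^ d

theorem summable_exp_mul_succ {γ : ℝ} (hγ : γ < 0) :
    Summable fun m : ℕ => Real.exp (γ * (m + 1)) := by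
  have := (summable_geometric_of_lt_one (Real.exp_pos γ).le (Real.exp_lt_one_iff.2 hγ)).mul_left
    (Real.exp γ)
  convert! this using 1
  funext m
  rw [← Real.exp_nat_mul, ← Real.exp_add]
  ring_nf

/-- The theta function decreases in its argument, so the first cycle bounds all the others. This
dominates both the cycle sum at fixed l and its limit. -/
theorem cycle_term_le {β μ l : ℝ} (hβ : 0 < β) (hl : 0 < l) (d m : ℕ) :
    Real.exp (β * μ * (m + 1)) / (m + 1) *
        gaussSum (2 * Real.pi ^ 2 * (β * (m + 1)) / l ^ 2) ^ d ≤
      Real.exp (β * μ * (m + 1)) * gaussSum (2 * Real.pi ^ 2 * β / l ^ 2) ^ d := by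
  have h1 : (1 : ℝ) ≤ m + 1 := by linarith [Nat.cast_nonneg (α := ℝ) m]
  have h2 : gaussSum (2 * Real.pi ^ 2 * (β * (m + 1)) / l ^ 2) ≤
      gaussSum (2 * Real.pi ^ 2 * β / l ^ 2) := by
    refine gaussSum_anti (by positivity) ?_
    gcongr
    nlinarith
  have h3 := gaussSum_nonneg (2 * Real.pi ^ 2 * (β * (m + 1)) / l ^ 2)
  gcongr
  exact div_le_self (Real.exp_pos _).le h1

/-- Expand -log(1 - x) = ∑ x^{m+1}/(m+1) and sum over the modes first: for fixed m the Gaussian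
factorizes over the d coordinates. -/
theorem hasSum_neg_log_one_sub {β μ l : ℝ} (hβ : 0 < β) (hμ : μ < 0) (hl : 0 < l) (d : ℕ) :
    HasSum (fun k : Mode d => -Real.log (1 - Real.exp (-β * (modeEnergy l k - μ))))
      (freeLogPartition d β μ l) := by
  let F : ℕ × Mode d → ℝ := fun p =>
    Real.exp (-β * (modeEnergy l p.2 - μ)) ^ (p.1 + 1) / (p.1 + 1)
  have hF0 : ∀ p, 0 ≤ F p := fun p => by positivity
  have hrow (m : ℕ) : HasSum (fun k => F (m, k)) (Real.exp (β * μ * (m + 1)) / (m + 1) *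
      gaussSum (2 * Real.pi ^ 2 * (β * (m + 1)) / l ^ 2) ^ d) := by
    have h := (hasSum_exp_modeEnergy (s := β * (m + 1)) (by positivity) hl d).mul_left
      (Real.exp (β * μ * (m + 1)) / (m + 1))
    convert! h using 1
    funext k
    simp only [F]
    rw [← Real.exp_nat_mul, div_mul_eq_mul_div, ← Real.exp_add]
    congr 2
    push_cast
    ring
  have hcol (k : Mode d) : HasSum (fun m => F (m, k))
      (-Real.log (1 - Real.exp (-β * (modeEnergy l k - μ)))) := by
    have hx : |Real.exp (-β * (modeEnergy l k - μ))| < 1 := by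
      rw [abs_of_pos (Real.exp_pos _), Real.exp_lt_one_iff]
      have := modeEnergy_nonneg l k
      nlinarith
    have h := Real.hasSum_pow_div_log_of_abs_lt_one hx
    exact h
  have hsum : Summable fun m : ℕ => Real.exp (β * μ * (m + 1)) / (m + 1) *
      gaussSum (2 * Real.pi ^ 2 * (β * (m + 1)) / l ^ 2) ^ d := by
    refine Summable.of_nonneg_of_le (fun m => ?_) (fun m => cycle_term_le hβ hl d m)
      ((summable_exp_mul_succ (mul_neg_of_pos_of_neg hβ hμ)).mul_right _)
    have := gaussSum_nonneg (2 * Real.pi ^ 2 * (β * (m + 1)) / l ^ 2)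
    positivity
  have hF : Summable F := by
    refine (summable_prod_of_nonneg hF0).2 ⟨fun m => (hrow m).summable, ?_⟩
    simpa only [(hrow _).tsum_eq] using hsum
  have hFS : HasSum F (freeLogPartition d β μ l) := by
    have := hF.hasSum.prod_fiberwise hrow
    rw [freeLogPartition, this.tsum_eq]
    exact hF.hasSum
  exact ((Equiv.prodComm _ _).hasSum_iff.2 hFS).prod_fiberwise hcol

theorem exists_tendsto_freeLogPartition {β μ : ℝ} (hβ : 0 < β) (hμ : μ < 0) (d : ℕ) :
    ∃ p, Tendsto (fun l => freeLogPartition d β μ l / l ^ d) atTop (𝓝 p) := by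
  have h1 := tendsto_gaussSum_div (c := 2 * Real.pi ^ 2 * β) (by positivity)
  obtain ⟨B, hB⟩ := h1.isBoundedUnder_le
  rw [eventually_map] at hB
  refine ⟨∑' m : ℕ, Real.exp (β * μ * (m + 1)) / (m + 1) *
    Real.sqrt (Real.pi / (2 * Real.pi ^ 2 * (β * (m + 1)))) ^ d, ?_⟩
  have key : Tendsto (fun l => ∑' m : ℕ, Real.exp (β * μ * (m + 1)) / (m + 1) *
      (gaussSum (2 * Real.pi ^ 2 * (β * (m + 1)) / l ^ 2) / l) ^ d) atTop
      (𝓝 (∑' m : ℕ, Real.exp (β * μ * (m + 1)) / (m + 1) *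
        Real.sqrt (Real.pi / (2 * Real.pi ^ 2 * (β * (m + 1)))) ^ d)) := by
    refine tendsto_tsum_of_dominated_convergence
      (bound := fun m : ℕ => Real.exp (β * μ * (m + 1)) * B ^ d)
      ((summable_exp_mul_succ (mul_neg_of_pos_of_neg hβ hμ)).mul_right _) (fun m => ?_) ?_
    · exact ((tendsto_gaussSum_div (by positivity)).pow d).const_mul _
    · filter_upwards [eventually_gt_atTop 0, hB] with l hl hBl m
      have h3 := gaussSum_nonneg (2 * Real.pi ^ 2 * (β * (m + 1)) / l ^ 2)
      have h4 := gaussSum_nonneg (2 * Real.pi ^ 2 * β / l ^ 2)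
      rw [Real.norm_of_nonneg (by positivity), div_pow, mul_div_assoc']
      refine (div_le_div_of_nonneg_right (cycle_term_le hβ hl d m) (by positivity)).trans ?_
      rw [mul_div_assoc, ← div_pow]
      gcongr
  refine key.congr fun l => ?_
  rw [freeLogPartition, ← tsum_div_const]
  refine tsum_congr fun m => ?_
  rw [div_pow, mul_div_assoc']

/-! ### A single mode with a strong square-root source -/

/-- The Boltzmann factor of `j` particles in a mode of energy `γ` with source strength `s`. -/
def modeWeight (γ s : ℝ) (j : ℕ) : ℝ := Real.exp (s * Real.sqrt (j + 1)) * Real.exp (-γ) ^ j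

/-- The partition function of a single mode. -/
def modeSum (γ s : ℝ) : ℝ := ∑' j, modeWeight γ s j

/-- The mean occupation of a single mode. -/
def modeMean (γ s : ℝ) : ℝ := (∑' j : ℕ, (j : ℝ) * modeWeight γ s j) / modeSum γ s

theorem modeWeight_pos (γ s : ℝ) (j : ℕ) : 0 < modeWeight γ s j := by
  unfold modeWeight; positivity

theorem modeWeight_eq (γ s : ℝ) (j : ℕ) :
    modeWeight γ s j = Real.exp (s * Real.sqrt (j + 1) - γ * j) := by
  rw [modeWeight, ← Real.exp_nat_mul, ← Real.exp_add]
  ring_nf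

theorem mul_sqrt_succ_le {α : ℝ} (hα : 0 < α) (s : ℝ) (j : ℕ) :
    s * Real.sqrt (j + 1) ≤ s ^ 2 / (4 * α) + α * (j + 1) := by
  have h : Real.sqrt (j + 1) ^ 2 = j + 1 := Real.sq_sqrt (by positivity)
  have h1 : 0 ≤ (s - 2 * α * Real.sqrt (j + 1)) ^ 2 / (4 * α) := by positivity
  have h2 : (s - 2 * α * Real.sqrt (j + 1)) ^ 2 / (4 * α) =
      s ^ 2 / (4 * α) - s * Real.sqrt (j + 1) + α * Real.sqrt (j + 1) ^ 2 := by
    field_simp; ring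
  rw [h2, h] at h1
  linarith

/-- Part γ - δ of the energy absorbs the source by completing the square; the rest, δ, is left to
make the sum over j geometric. -/
theorem modeWeight_le {γ δ : ℝ} (hδγ : δ < γ) (s : ℝ) (j : ℕ) :
    modeWeight γ s j ≤
      Real.exp (s ^ 2 / (4 * (γ - δ)) + (γ - δ)) * Real.exp (-δ) ^ j := by
  rw [modeWeight_eq, ← Real.exp_nat_mul, ← Real.exp_add]
  refine Real.exp_le_exp.2 ?_
  have := mul_sqrt_succ_le (sub_pos.2 hδγ) s j
  linarith

theorem summable_modeWeight {γ : ℝ} (hγ : 0 < γ) (s : ℝ) : Summable (modeWeight γ s) :=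
  Summable.of_nonneg_of_le (fun j => (modeWeight_pos γ s j).le)
    (fun j => modeWeight_le (half_lt_self hγ) s j)
    ((summable_geometric_of_lt_one (Real.exp_pos _).le
      (Real.exp_lt_one_iff.2 (by linarith))).mul_left _)

theorem summable_mul_modeWeight {γ : ℝ} (hγ : 0 < γ) (s : ℝ) :
    Summable fun j : ℕ => (j : ℝ) * modeWeight γ s j := by
  have hx : ‖Real.exp (-(γ / 2))‖ < 1 := by
    rw [Real.norm_of_nonneg (Real.exp_pos _).le, Real.exp_lt_one_iff]
    linarith
  refine Summable.of_nonneg_of_le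
    (fun j => mul_nonneg (Nat.cast_nonneg _) (modeWeight_pos γ s j).le)
    (fun j => mul_le_mul_of_nonneg_left (modeWeight_le (half_lt_self hγ) s j) (Nat.cast_nonneg _))
    ?_
  convert! (summable_pow_mul_geometric_of_norm_lt_one 1 hx).mul_left
    (Real.exp (s ^ 2 / (4 * (γ - γ / 2)) + (γ - γ / 2))) using 1
  funext j
  ring

theorem modeSum_pos {γ : ℝ} (hγ : 0 < γ) (s : ℝ) : 0 < modeSum γ s :=
  (summable_modeWeight hγ s).tsum_pos (fun j => (modeWeight_pos γ s j).le) 0 (modeWeight_pos γ s 0)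

theorem modeSum_le {γ δ : ℝ} (hδ : 0 < δ) (hδγ : δ < γ) (s : ℝ) :
    modeSum γ s ≤ Real.exp (s ^ 2 / (4 * (γ - δ)) + (γ - δ)) * (1 - Real.exp (-δ))⁻¹ := by
  have hx : Real.exp (-δ) < 1 := Real.exp_lt_one_iff.2 (by linarith)
  exact hasSum_le (fun j => modeWeight_le hδγ s j) (summable_modeWeight (hδ.trans hδγ) s).hasSum
    ((hasSum_geometric_of_lt_one (Real.exp_pos _).le hx).mul_left _)

/-- One term suffices. The exponent sy - γy² is maximal at y = s/(2γ), and j = ⌊y²⌋ errs on the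
favourable side in both places, as j ≤ y² and y ≤ √(j + 1). -/
theorem exp_le_modeSum {γ : ℝ} (hγ : 0 < γ) {s : ℝ} (hs : 0 ≤ s) :
    Real.exp (s ^ 2 / (4 * γ)) ≤ modeSum γ s := by
  set y := s / (2 * γ) with hy
  have hy0 : 0 ≤ y := by positivity
  set j := ⌊y ^ 2⌋₊
  have h1 : (j : ℝ) ≤ y ^ 2 := Nat.floor_le (by positivity)
  have h2 : y ≤ Real.sqrt (j + 1) := Real.le_sqrt_of_sq_le (Nat.lt_floor_add_one (y ^ 2)).le
  refine le_trans ?_ ((summable_modeWeight hγ s).le_tsum j fun i _ => (modeWeight_pos γ s i).le)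
  rw [modeWeight_eq]
  refine Real.exp_le_exp.2 ?_
  have h3 : s ^ 2 / (4 * γ) = s * y - γ * y ^ 2 := by
    rw [hy]; field_simp; ring
  rw [h3]
  have := mul_le_mul_of_nonneg_left h2 hs
  have := mul_le_mul_of_nonneg_left h1 hγ.le
  linarith

theorem tendsto_log_modeSum_div_sq {γ : ℝ} (hγ : 0 < γ) :
    Tendsto (fun s => Real.log (modeSum γ s) / s ^ 2) atTop (𝓝 (1 / (4 * γ))) := by
  refine tendsto_order.2 ⟨fun a ha => ?_, fun a ha => ?_⟩
  · filter_upwards [eventually_gt_atTop 0] with s hs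
    refine ha.trans_le ?_
    rw [le_div_iff₀ (by positivity), Real.le_log_iff_exp_le (modeSum_pos hγ s), one_div_mul_eq_div]
    exact exp_le_modeSum hγ hs.le
  -- The upper bound is sharp only as δ → 0 but needs δ > 0 for convergence; the room below a allows
  -- a small positive δ.
  · have hc : ContinuousAt (fun δ : ℝ => 1 / (4 * (γ - δ))) 0 := by
      refine ContinuousAt.div continuousAt_const (by fun_prop) ?_
      simpa using hγ.ne'
    have h1 : ∀ᶠ δ : ℝ in 𝓝[>] 0, 1 / (4 * (γ - δ)) < a :=
      (hc.eventually_lt continuousAt_const (by simpa using ha)).filter_mono nhdsWithin_le_nhds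
    have h2 : ∀ᶠ δ : ℝ in 𝓝[>] 0, δ < γ :=
      (eventually_lt_nhds hγ).filter_mono nhdsWithin_le_nhds
    obtain ⟨δ, hδa, hδγ, hδ⟩ := (h1.and (h2.and eventually_mem_nhdsWithin)).exists
    have hδ : 0 < δ := hδ
    have hx : Real.exp (-δ) < 1 := Real.exp_lt_one_iff.2 (by linarith)
    set C := (γ - δ) + Real.log (1 - Real.exp (-δ))⁻¹
    have h3 : Tendsto (fun s : ℝ => 1 / (4 * (γ - δ)) + C / s ^ 2) atTop
        (𝓝 (1 / (4 * (γ - δ)) + 0)) :=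
      tendsto_const_nhds.add (tendsto_const_nhds.div_atTop (tendsto_pow_atTop two_ne_zero))
    rw [add_zero] at h3
    filter_upwards [eventually_gt_atTop 0, h3.eventually_lt_const hδa] with s hs hsa
    refine lt_of_le_of_lt ?_ hsa
    have h4 := Real.log_le_log (modeSum_pos hγ s) (modeSum_le hδ hδγ s)
    have h5 : 0 < (1 - Real.exp (-δ))⁻¹ := inv_pos.2 (by linarith)
    rw [Real.log_mul (Real.exp_pos _).ne' h5.ne', Real.log_exp] at h4
    have h6 : (1 / (4 * (γ - δ)) + C / s ^ 2) * s ^ 2 = s ^ 2 / (4 * (γ - δ)) + C := by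
      field_simp
    rw [div_le_iff₀ (by positivity), h6]
    linarith

/-- The tangent-line inequality for γ ↦ log Z, whose derivative is minus the mean. It is Jensen's
inequality, obtained from x + 1 ≤ e^x at x = (γ - γ')(j - m). -/
theorem mul_modeMean_le {γ γ' : ℝ} (hγ : 0 < γ) (hγ' : 0 < γ') (s : ℝ) :
    (γ - γ') * modeMean γ s ≤ Real.log (modeSum γ' s) - Real.log (modeSum γ s) := by
  set m := modeMean γ s with hm
  have hZ := modeSum_pos hγ s
  have h1 : Summable (modeWeight γ s) := summable_modeWeight hγ s
  have h2 := summable_mul_modeWeight hγ s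
  have hle (j : ℕ) : Real.exp ((γ - γ') * m) * ((1 - (γ - γ') * m) * modeWeight γ s j +
      (γ - γ') * (j * modeWeight γ s j)) ≤ modeWeight γ' s j := by
    have he : modeWeight γ' s j = Real.exp ((γ - γ') * m) *
        (Real.exp ((γ - γ') * (j - m)) * modeWeight γ s j) := by
      rw [modeWeight_eq, modeWeight_eq, ← Real.exp_add, ← Real.exp_add]
      ring_nf
    rw [he]
    refine mul_le_mul_of_nonneg_left ?_ (Real.exp_pos _).le
    have h3 := mul_le_mul_of_nonneg_right (Real.add_one_le_exp ((γ - γ') * (j - m)))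
      (modeWeight_pos γ s j).le
    linarith
  have h4 := hasSum_le hle (((h1.hasSum.mul_left (1 - (γ - γ') * m)).add
    (h2.hasSum.mul_left (γ - γ'))).mul_left (Real.exp ((γ - γ') * m)))
    (summable_modeWeight hγ' s).hasSum
  have h5 : (∑' j : ℕ, (j : ℝ) * modeWeight γ s j) = m * modeSum γ s := by
    rw [hm, modeMean, div_mul_cancel₀ _ hZ.ne']
  rw [h5] at h4
  change Real.exp ((γ - γ') * m) * ((1 - (γ - γ') * m) * modeSum γ s +
    (γ - γ') * (m * modeSum γ s)) ≤ modeSum γ' s at h4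
  have h6 : (1 - (γ - γ') * m) * modeSum γ s + (γ - γ') * (m * modeSum γ s) = modeSum γ s := by
    ring
  rw [h6] at h4
  have h7 := Real.log_le_log (by positivity) h4
  rw [Real.log_mul (Real.exp_pos _).ne' hZ.ne', Real.log_exp] at h7
  linarith

/-- Griffiths' argument: convexity traps the mean between difference quotients of log Z on the two
sides of γ. Divided by s², these tend to 1/(4γγ'), and then γ' → γ. -/
theorem tendsto_modeMean_div_sq {γ : ℝ} (hγ : 0 < γ) :
    Tendsto (fun s => modeMean γ s / s ^ 2) atTop (𝓝 (1 / (4 * γ ^ 2))) := by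
  have hlim {γ' : ℝ} (hγ' : 0 < γ') (hne : γ' ≠ γ) :
      Tendsto (fun s => (Real.log (modeSum γ' s) / s ^ 2 - Real.log (modeSum γ s) / s ^ 2) /
        (γ - γ')) atTop (𝓝 (1 / (4 * γ * γ'))) := by
    have h := ((tendsto_log_modeSum_div_sq hγ').sub (tendsto_log_modeSum_div_sq hγ)).div_const
      (γ - γ')
    have hne' : γ - γ' ≠ 0 := sub_ne_zero.2 hne.symm
    convert! h using 2
    field_simp
  have hc : ContinuousAt (fun γ' : ℝ => 1 / (4 * γ * γ')) γ :=
    ContinuousAt.div continuousAt_const (by fun_prop) (by positivity)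
  have hval : 1 / (4 * γ * γ) = 1 / (4 * γ ^ 2) := by ring_nf
  refine tendsto_order.2 ⟨fun a ha => ?_, fun a ha => ?_⟩
  · have h1 : ∀ᶠ γ' : ℝ in 𝓝[>] γ, a < 1 / (4 * γ * γ') :=
      (continuousAt_const.eventually_lt hc (by rwa [hval])).filter_mono nhdsWithin_le_nhds
    obtain ⟨γ', hγa, hγγ'⟩ := (h1.and eventually_mem_nhdsWithin).exists
    have hγγ' : γ < γ' := hγγ'
    have hγ' := hγ.trans hγγ'
    filter_upwards [(hlim hγ' hγγ'.ne').eventually_const_lt hγa, eventually_gt_atTop 0] with s hs hs0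
    refine hs.trans_le ?_
    have h2 := mul_modeMean_le hγ hγ' s
    rw [← sub_div, div_div, mul_comm, ← div_div]
    gcongr
    rw [div_le_iff_of_neg (by linarith), mul_comm]
    exact h2
  · have h1 : ∀ᶠ γ' : ℝ in 𝓝[<] γ, 1 / (4 * γ * γ') < a :=
      (hc.eventually_lt continuousAt_const (by rwa [hval])).filter_mono nhdsWithin_le_nhds
    have h1' : ∀ᶠ γ' : ℝ in 𝓝[<] γ, 0 < γ' :=
      (eventually_gt_nhds hγ).filter_mono nhdsWithin_le_nhds
    obtain ⟨γ', hγa, hγ', hγγ'⟩ := (h1.and (h1'.and eventually_mem_nhdsWithin)).exists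
    have hγγ' : γ' < γ := hγγ'
    filter_upwards [(hlim hγ' hγγ'.ne).eventually_lt_const hγa, eventually_gt_atTop 0] with s hs hs0
    refine lt_of_le_of_lt ?_ hs
    have h2 := mul_modeMean_le hγ hγ' s
    rw [← sub_div, div_div, mul_comm (s ^ 2), ← div_div]
    gcongr
    rw [le_div_iff₀ (by linarith), mul_comm]
    exact h2

/-! ### Traces of the two models -/

theorem exp_freeEnergy_eq (β μ l : ℝ) (n : Config d) : Real.exp (-β * freeEnergy d μ l n) =
    n.prod fun k m => Real.exp (-β * (modeEnergy l k - μ)) ^ m := by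
  rw [freeEnergy, Finsupp.sum, Finset.mul_sum, Real.exp_sum, Finsupp.prod]
  refine Finset.prod_congr rfl fun k _ => ?_
  rw [← Real.exp_nat_mul]
  ring_nf

theorem hasSum_exp_freeEnergy {β μ l : ℝ} (hβ : 0 < β) (hμ : μ < 0) (hl : 0 < l) :
    HasSum (fun n : Config d => Real.exp (-β * freeEnergy d μ l n))
      (Real.exp (freeLogPartition d β μ l)) := by
  simp only [exp_freeEnergy_eq]
  refine hasSum_prod_pow (fun k => (Real.exp_pos _).le) (fun k => ?_)
    (hasSum_neg_log_one_sub hβ hμ hl d)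
  have := modeEnergy_nonneg l k
  rw [Real.exp_lt_one_iff]
  nlinarith

theorem exists_hasSum_exp_freeEnergy {β μ l : ℝ} (hβ : 0 < β) (hμ : μ < 0) (hl : 0 < l) :
    ∃ R : ℝ, 0 < R ∧ ∀ (h : ℕ → ℝ) (t : ℝ), (∀ j, 0 ≤ h j) →
      HasSum (fun j => h j * Real.exp (-(β * -μ)) ^ j) t →
        HasSum (fun n : Config d => h (n 0) * Real.exp (-β * freeEnergy d μ l n)) (R * t) := by
  have h := hasSum_exp_freeEnergy (d := d) hβ hμ hl
  simp only [exp_freeEnergy_eq] at h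
  obtain ⟨R, hR, H⟩ := exists_hasSum_zeroMode (fun k => (Real.exp_pos _).le) (k := 0) h
  refine ⟨R, hR, fun h t hh ht => ?_⟩
  simp only [exp_freeEnergy_eq]
  refine H h t hh ?_
  convert! ht using 4
  rw [modeEnergy_zero]
  ring_nf

theorem hasSum_mul_norm_ket_sq (f : Config d → ℝ) (n : Config d) :
    HasSum (fun m => f m * ‖(ket n : Fock d) m‖ ^ 2) (f n) := by
  have h := hasSum_single (f := fun m => f m * ‖(ket n : Fock d) m‖ ^ 2) n fun m hm => by
    simp [ket_apply, hm]
  simpa [ket_apply] using h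

theorem exp_app_eq (β E ν V y : ℝ) :
    Real.exp (-β * (E - 2 * ν * V * y)) = Real.exp (2 * β * ν * V * y) * Real.exp (-β * E) := by
  rw [← Real.exp_add]
  ring_nf

theorem hasSum_modeSum_zero {γ : ℝ} (hγ : 0 < γ) :
    HasSum (fun j : ℕ => 1 * Real.exp (-γ) ^ j) (modeSum γ 0) := by
  convert! (summable_modeWeight hγ 0).hasSum using 1
  funext j
  simp [modeWeight]

/-- The source touches only the zero mode, so the free and perturbed traces share the factor R of
the other modes. -/
theorem app_hasSum {β μ l : ℝ} (hβ : 0 < β) (hμ : μ < 0) (ν : ℝ) (hl : 0 < l) :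
    ∃ R : ℝ, 0 < R ∧ Real.exp (freeLogPartition d β μ l) = R * modeSum (β * -μ) 0 ∧
      HasSum (weight (appHamiltonian d μ ν l) β)
        (R * modeSum (β * -μ) (2 * β * ν * Real.sqrt (volume d l))) ∧
      HasSum (fun n : Config d => (n 0 : ℝ) * weight (appHamiltonian d μ ν l) β n)
        (R * (modeMean (β * -μ) (2 * β * ν * Real.sqrt (volume d l)) *
          modeSum (β * -μ) (2 * β * ν * Real.sqrt (volume d l)))) := by
  have hγ : 0 < β * -μ := mul_pos hβ (by linarith)
  obtain ⟨R, hR, H⟩ := exists_hasSum_exp_freeEnergy (d := d) hβ hμ hl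
  have hd := appHamiltonian_diagonalizes (d := d) hμ ν l
  set s := 2 * β * ν * Real.sqrt (volume d l) with hs
  have hZ : HasSum (modeWeight (β * -μ) s) (modeSum (β * -μ) s) :=
    (summable_modeWeight hγ s).hasSum
  have hZ1 := (summable_mul_modeWeight hγ s).hasSum
  rw [show (∑' j : ℕ, (j : ℝ) * modeWeight (β * -μ) s j) =
    modeMean (β * -μ) s * modeSum (β * -μ) s from
      (div_mul_cancel₀ _ (modeSum_pos hγ s).ne').symm] at hZ1
  refine ⟨R, hR, ?_, ?_, ?_⟩
  · refine (hasSum_exp_freeEnergy hβ hμ hl).unique ?_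
    simpa only [one_mul] using
      H (fun _ => 1) _ (fun _ => zero_le_one) (hasSum_modeSum_zero hγ)
  · have h1 := hd.hasSum_mul_weight hβ (f := fun _ => 1) (fun _ => zero_le_one) (M := fun _ => 1)
      (S := R * modeSum (β * -μ) s)
      (fun n => by rw [ketBasis_apply]; exact hasSum_mul_norm_ket_sq (fun _ => 1) n) ?_
    · simpa only [one_mul] using h1
    · have := H (fun j => Real.exp (s * Real.sqrt (j + 1))) _ (fun _ => (Real.exp_pos _).le) hZ
      convert! this using 1
      funext n
      rw [exp_app_eq, mul_one]
  · refine hd.hasSum_mul_weight hβ (f := fun n : Config d => (n 0 : ℝ))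
      (fun _ => Nat.cast_nonneg _) (M := fun n => (n 0 : ℝ))
      (fun n => by
        rw [ketBasis_apply]; exact hasSum_mul_norm_ket_sq (fun n : Config d => (n 0 : ℝ)) n) ?_
    have := H (fun j => j * Real.exp (s * Real.sqrt (j + 1))) _
      (fun j => mul_nonneg (Nat.cast_nonneg _) (Real.exp_pos _).le)
      (by simpa only [modeWeight, mul_assoc] using hZ1)
    convert! this using 1
    funext n
    rw [exp_app_eq]
    ring

theorem ideal_hasSum {β μ l : ℝ} (hβ : 0 < β) (hμ : μ < 0) (ν φ : ℝ) (hl : 0 < l) :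
    HasSum (weight (idealHamiltonian d μ ν φ l) β)
      (Real.exp (β * ((ν * Real.sqrt (volume d l)) ^ 2 / (-μ)) + freeLogPartition d β μ l)) ∧
    HasSum (fun n : Config d => (n 0 : ℝ) * weight (idealHamiltonian d μ ν φ l) β n)
      ((modeMean (β * -μ) 0 + (ν * Real.sqrt (volume d l) / (-μ)) ^ 2) *
        Real.exp (β * ((ν * Real.sqrt (volume d l)) ^ 2 / (-μ)) + freeLogPartition d β μ l)) := by
  have hγ : 0 < β * -μ := mul_pos hβ (by linarith)
  have hd := idealHamiltonian_diagonalizes (d := d) hμ ν φ l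
  set κ := ν * Real.sqrt (volume d l)
  have hE (x : ℝ) : Real.exp (-β * (x - κ ^ 2 / (-μ))) =
      Real.exp (β * (κ ^ 2 / (-μ))) * Real.exp (-β * x) := by
    rw [← Real.exp_add]; ring_nf
  have hfree := hasSum_exp_freeEnergy (d := d) hβ hμ hl
  constructor
  · have h1 := hd.hasSum_mul_weight hβ (f := fun _ => 1) (fun _ => zero_le_one) (M := fun _ => 1)
      (S := Real.exp (β * (κ ^ 2 / (-μ)) + freeLogPartition d β μ l)) (fun c => ?_) ?_
    · simpa only [one_mul] using h1
    · rw [displacedBasis_apply]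
      refine hasSum_mul_norm_displacedState_sq (f := fun _ => 1) ?_
      simpa using hasSum_displaced_mul (κ / (-μ)) (c 0) (c 0)
    · simpa only [mul_one, hE, Real.exp_add] using hfree.mul_left (Real.exp (β * (κ ^ 2 / (-μ))))
  · refine hd.hasSum_mul_weight hβ (f := fun n : Config d => (n 0 : ℝ))
      (fun _ => Nat.cast_nonneg _) (M := fun c => (c 0 : ℝ) + (κ / (-μ)) ^ 2) (fun c => ?_) ?_
    · rw [displacedBasis_apply]
      exact hasSum_mul_norm_displacedState_sq (f := fun j => (j : ℝ))
        (hasSum_nat_mul_displaced_sq (κ / (-μ)) (c 0))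
    · obtain ⟨R, hR, H⟩ := exists_hasSum_exp_freeEnergy (d := d) hβ hμ hl
      have h0 := H (fun _ => 1) _ (fun _ => zero_le_one)
        (hasSum_modeSum_zero hγ)
      have hRL : Real.exp (freeLogPartition d β μ l) = R * modeSum (β * -μ) 0 := by
        refine hfree.unique ?_
        simpa only [one_mul] using h0
      have hZ1 := (summable_mul_modeWeight hγ 0).hasSum
      rw [show (∑' j : ℕ, (j : ℝ) * modeWeight (β * -μ) 0 j) =
        modeMean (β * -μ) 0 * modeSum (β * -μ) 0 from
          (div_mul_cancel₀ _ (modeSum_pos hγ 0).ne').symm] at hZ1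
      have h1 := H (fun j => j) _ (fun j => Nat.cast_nonneg _)
        (by simpa only [modeWeight, zero_mul, Real.exp_zero, one_mul] using hZ1)
      have h2 := (h1.add (hfree.mul_left ((κ / (-μ)) ^ 2))).mul_left
        (Real.exp (β * (κ ^ 2 / (-μ))))
      convert! h2 using 1
      · funext c
        rw [hE]
        ring
      · rw [Real.exp_add, hRL]
        ring

/-! ### Thermodynamic limit -/

theorem volume_pos {l : ℝ} (hl : 0 < l) : 0 < volume d l := pow_pos hl d

theorem tendsto_volume (hd : 1 ≤ d) : Tendsto (volume d) atTop atTop :=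
  tendsto_pow_atTop (by omega)

theorem app_hasGibbsState {β μ l : ℝ} (hβ : 0 < β) (hμ : μ < 0) (ν : ℝ) (hl : 0 < l) :
    HasGibbsState (appHamiltonian d μ ν l) β := by
  obtain ⟨R, hR, -, h1, h2⟩ := app_hasSum (d := d) hβ hμ ν hl
  obtain ⟨T, hT, -⟩ := (appHamiltonian_diagonalizes (d := d) hμ ν l).exists_boltzmann hβ
  refine ⟨⟨T, hT⟩, h1.summable, ?_, h2.summable⟩
  rw [partitionFunction, h1.tsum_eq]
  exact mul_pos hR (modeSum_pos (mul_pos hβ (by linarith)) _)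

theorem ideal_hasGibbsState {β μ l : ℝ} (hβ : 0 < β) (hμ : μ < 0) (ν φ : ℝ) (hl : 0 < l) :
    HasGibbsState (idealHamiltonian d μ ν φ l) β := by
  obtain ⟨h1, h2⟩ := ideal_hasSum (d := d) hβ hμ ν φ hl
  obtain ⟨T, hT, -⟩ := (idealHamiltonian_diagonalizes (d := d) hμ ν φ l).exists_boltzmann hβ
  refine ⟨⟨T, hT⟩, h1.summable, ?_, h2.summable⟩
  rw [partitionFunction, h1.tsum_eq]
  exact Real.exp_pos _

theorem app_log_partitionFunction {β μ l : ℝ} (hβ : 0 < β) (hμ : μ < 0) (ν : ℝ) (hl : 0 < l) :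
    Real.log (partitionFunction (appHamiltonian d μ ν l) β) = freeLogPartition d β μ l +
      (Real.log (modeSum (β * -μ) (2 * β * ν * Real.sqrt (volume d l))) -
        Real.log (modeSum (β * -μ) 0)) := by
  have hγ : 0 < β * -μ := mul_pos hβ (by linarith)
  obtain ⟨R, hR, hRL, h1, -⟩ := app_hasSum (d := d) hβ hμ ν hl
  have h := congrArg Real.log hRL
  rw [Real.log_exp, Real.log_mul hR.ne' (modeSum_pos hγ 0).ne'] at h
  rw [partitionFunction, h1.tsum_eq, Real.log_mul hR.ne' (modeSum_pos hγ _).ne', h]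
  ring

theorem app_zeroModeOccupation {β μ l : ℝ} (hβ : 0 < β) (hμ : μ < 0) (ν : ℝ) (hl : 0 < l) :
    zeroModeOccupation (appHamiltonian d μ ν l) β =
      modeMean (β * -μ) (2 * β * ν * Real.sqrt (volume d l)) := by
  have hγ : 0 < β * -μ := mul_pos hβ (by linarith)
  obtain ⟨R, hR, -, h1, h2⟩ := app_hasSum (d := d) hβ hμ ν hl
  have hZ := (modeSum_pos hγ (2 * β * ν * Real.sqrt (volume d l))).ne'
  rw [zeroModeOccupation, partitionFunction, h1.tsum_eq, h2.tsum_eq,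
    mul_div_mul_left _ _ hR.ne', mul_div_cancel_right₀ _ hZ]

theorem ideal_log_partitionFunction {β μ l : ℝ} (hβ : 0 < β) (hμ : μ < 0) (ν φ : ℝ) (hl : 0 < l) :
    Real.log (partitionFunction (idealHamiltonian d μ ν φ l) β) =
      β * (ν ^ 2 * volume d l / (-μ)) + freeLogPartition d β μ l := by
  rw [partitionFunction, (ideal_hasSum (d := d) hβ hμ ν φ hl).1.tsum_eq, Real.log_exp, mul_pow,
    Real.sq_sqrt (volume_pos hl).le]

theorem ideal_zeroModeOccupation {β μ l : ℝ} (hβ : 0 < β) (hμ : μ < 0) (ν φ : ℝ) (hl : 0 < l) :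
    zeroModeOccupation (idealHamiltonian d μ ν φ l) β =
      modeMean (β * -μ) 0 + ν ^ 2 * volume d l / μ ^ 2 := by
  obtain ⟨h1, h2⟩ := ideal_hasSum (d := d) hβ hμ ν φ hl
  rw [zeroModeOccupation, partitionFunction, h1.tsum_eq, h2.tsum_eq,
    mul_div_cancel_right₀ _ (Real.exp_pos _).ne', div_pow, mul_pow,
    Real.sq_sqrt (volume_pos hl).le, neg_sq]

theorem tendsto_source_strength {β ν : ℝ} (hβ : 0 < β) (hν : 0 < ν) (hd : 1 ≤ d) :
    Tendsto (fun l => 2 * β * ν * Real.sqrt (volume d l)) atTop atTop :=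
  (Real.tendsto_sqrt_atTop.comp (tendsto_volume hd)).const_mul_atTop (by positivity)

theorem source_strength_sq {β ν l : ℝ} (hl : 0 < l) :
    (2 * β * ν * Real.sqrt (volume d l)) ^ 2 = 4 * β ^ 2 * ν ^ 2 * volume d l := by
  rw [mul_pow, Real.sq_sqrt (volume_pos hl).le]
  ring

theorem app_hasCondensateDensity {β μ ν : ℝ} (hβ : 0 < β) (hμ : μ < 0) (hν : 0 < ν) (hd : 1 ≤ d) :
    HasCondensateDensity (appHamiltonian d μ ν) β (ν ^ 2 / μ ^ 2) := by
  have hγ : 0 < β * -μ := mul_pos hβ (by linarith)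
  have h := ((tendsto_modeMean_div_sq hγ).comp
    (tendsto_source_strength (d := d) hβ hν hd)).const_mul (4 * β ^ 2 * ν ^ 2)
  -- Here the temperature drops out: s²/V and γ² both scale as β².
  have hval : 4 * β ^ 2 * ν ^ 2 * (1 / (4 * (β * -μ) ^ 2)) = ν ^ 2 / μ ^ 2 := by
    rw [mul_pow, neg_sq]
    field_simp
  rw [hval] at h
  refine h.congr' ?_
  filter_upwards [eventually_gt_atTop 0] with l hl
  have hV := (volume_pos (d := d) hl).ne'
  rw [app_zeroModeOccupation hβ hμ ν hl, Function.comp, source_strength_sq hl]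
  field_simp

theorem ideal_hasCondensateDensity {β μ ν : ℝ} (φ : ℝ) (hβ : 0 < β) (hμ : μ < 0) (hd : 1 ≤ d) :
    HasCondensateDensity (idealHamiltonian d μ ν φ) β (ν ^ 2 / μ ^ 2) := by
  have h : Tendsto (fun l => modeMean (β * -μ) 0 / volume d l + ν ^ 2 / μ ^ 2) atTop
      (𝓝 (0 + ν ^ 2 / μ ^ 2)) :=
    (tendsto_const_nhds.div_atTop (tendsto_volume hd)).add tendsto_const_nhds
  rw [zero_add] at h
  refine h.congr' ?_
  filter_upwards [eventually_gt_atTop 0] with l hl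
  have hV := (volume_pos (d := d) hl).ne'
  rw [ideal_zeroModeOccupation hβ hμ ν φ hl]
  field_simp

theorem tendsto_pressure_app {β μ ν p : ℝ} (hβ : 0 < β) (hμ : μ < 0) (hν : 0 < ν) (hd : 1 ≤ d)
    (hp : Tendsto (fun l => freeLogPartition d β μ l / l ^ d) atTop (𝓝 p)) :
    Tendsto (pressure (appHamiltonian d μ ν) β) atTop (𝓝 (p / β + ν ^ 2 / (-μ))) := by
  have hγ : 0 < β * -μ := mul_pos hβ (by linarith)
  have h1 := ((tendsto_log_modeSum_div_sq hγ).comp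
    (tendsto_source_strength (d := d) hβ hν hd)).const_mul (4 * β * ν ^ 2)
  have h2 : Tendsto (fun l => Real.log (modeSum (β * -μ) 0) / β / volume d l) atTop (𝓝 0) :=
    tendsto_const_nhds.div_atTop (tendsto_volume hd)
  have h := ((hp.div_const β).add h1).sub h2
  have hval : p / β + 4 * β * ν ^ 2 * (1 / (4 * (β * -μ))) - 0 = p / β + ν ^ 2 / (-μ) := by
    have := hμ.ne
    field_simp
    ring
  rw [hval] at h
  refine h.congr' ?_
  filter_upwards [eventually_gt_atTop 0] with l hl
  have hV := (volume_pos (d := d) hl).ne'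
  rw [pressure, app_log_partitionFunction hβ hμ ν hl, Function.comp, source_strength_sq hl,
    ← volume]
  field_simp
  ring

theorem tendsto_pressure_ideal {β μ p : ℝ} (ν φ : ℝ) (hβ : 0 < β) (hμ : μ < 0)
    (hp : Tendsto (fun l => freeLogPartition d β μ l / l ^ d) atTop (𝓝 p)) :
    Tendsto (pressure (idealHamiltonian d μ ν φ) β) atTop (𝓝 (p / β + ν ^ 2 / (-μ))) := by
  refine ((hp.div_const β).add_const _).congr' ?_
  filter_upwards [eventually_gt_atTop 0] with l hl
  have hV := (volume_pos (d := d) hl).ne'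
  rw [pressure, ideal_log_partitionFunction hβ hμ ν φ hl, ← volume]
  have := hμ.ne
  field_simp
  ring

end BoseGas

end

theorem theorem2 (d : ℕ) (hd : 1 ≤ d) (μ ν φ : ℝ) (hμ : μ < 0) (hν : 0 < ν) :
    (∀ β : ℝ, 0 < β → ∀ l : ℝ, 0 < l →
      BoseGas.HasGibbsState (BoseGas.idealHamiltonian d μ ν φ l) β ∧
        BoseGas.HasGibbsState (BoseGas.appHamiltonian d μ ν l) β) ∧
    (∀ β : ℝ, 0 < β → ∃ p : ℝ,
      Tendsto (BoseGas.pressure (BoseGas.idealHamiltonian d μ ν φ) β) atTop (𝓝 p) ∧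
        Tendsto (BoseGas.pressure (BoseGas.appHamiltonian d μ ν) β) atTop (𝓝 p)) ∧
    (BoseGas.NonConventionalCondensation (BoseGas.appHamiltonian d μ ν) ↔
      BoseGas.NonConventionalCondensation (BoseGas.idealHamiltonian d μ ν φ)) ∧
    BoseGas.NonConventionalCondensation (BoseGas.appHamiltonian d μ ν) ∧
    BoseGas.NonConventionalCondensation (BoseGas.idealHamiltonian d μ ν φ) ∧
    (∀ β : ℝ, 0 < β →
      BoseGas.HasCondensateDensity (BoseGas.appHamiltonian d μ ν) β (ν ^ 2 / μ ^ 2) ∧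
        BoseGas.HasCondensateDensity (BoseGas.idealHamiltonian d μ ν φ) β (ν ^ 2 / μ ^ 2)) := by
  have hρ : 0 < ν ^ 2 / μ ^ 2 := div_pos (pow_pos hν 2) (sq_pos_of_neg hμ)
  have happ : BoseGas.NonConventionalCondensation (BoseGas.appHamiltonian d μ ν) :=
    ⟨_, hρ, fun β hβ => BoseGas.app_hasCondensateDensity hβ hμ hν hd⟩
  have hideal : BoseGas.NonConventionalCondensation (BoseGas.idealHamiltonian d μ ν φ) :=
    ⟨_, hρ, fun β hβ => BoseGas.ideal_hasCondensateDensity φ hβ hμ hd⟩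
  refine ⟨fun β hβ l hl => ⟨BoseGas.ideal_hasGibbsState hβ hμ ν φ hl,
    BoseGas.app_hasGibbsState hβ hμ ν hl⟩, fun β hβ => ?_, iff_of_true happ hideal, happ, hideal,
    fun β hβ => ⟨BoseGas.app_hasCondensateDensity hβ hμ hν hd,
      BoseGas.ideal_hasCondensateDensity φ hβ hμ hd⟩⟩
  obtain ⟨p, hp⟩ := BoseGas.exists_tendsto_freeLogPartition hβ hμ d
  exact ⟨_, BoseGas.tendsto_pressure_ideal ν φ hβ hμ hp,
    BoseGas.tendsto_pressure_app hβ hμ hν hd hp⟩
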